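/- **Setting.** Let $K\ge 1$ users be served by a base station with $N=2\tilde N+1$ antennas (wavelength $\lambda_c>0$, spacing $d>0$), user $k$ being at angle $\theta_k$ and distance $d_k>0$; write $[\mathbf a(\theta,r)]_n=\exp\!\big(-j\tfrac{2\pi}{\lambda_c}(-nd\cos\theta+\tfrac{n^2d^2\sin^2\theta}{2r})\big)$, $-\tilde N\le n\le\tilde N$, $\alpha=(\lambda_c/4\pi)^2$, $\mathbf h_k=\frac{\sqrt\alpha}{d_k}\mathbf a(\theta_k,d_k)$, $\mathbf H_k=\mathbf h_k\mathbf h_k^H$. Let $\sigma_k^2>0$ and $\sigma_{\rm E}^2>0$ be the noise powers at user $k$ and at the eavesdropper, $P_{\max}>0$, $\tilde R_k=2^{\overline R_{{\rm info},k}}-1$ with $\overline R_{{\rm info},k}\ge0$ and $\tilde R_{{\rm leak},k}=2^{\overline R_{{\rm leak},k}}-1$ with $\overline R_{{\rm leak},k}>0$. The eavesdropper has predicted state $\bar{\mathbf s}=(\bar\theta,\bar d,v_x,v_y)$, $\bar d>0$, with positive definite covariance $\mathbf C_0$. Put $\bar{\mathbf a}=\mathbf a(\bar\theta,\bar d)$,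 $\mathbf U=[\mathbf I_N\ \bar{\mathbf a}]$, $\beta_d=9[\mathbf C_0]_{22}$ and $$\beta_{\mathbf a}=\max\Big\{\sum_n\vartheta_n(\Delta\theta,\Delta d)^2:\ |\Delta\theta|\le3\sqrt{[\mathbf C_0]_{11}},\ |\Delta d|\le3\sqrt{[\mathbf C_0]_{22}}\Big\},$$ $$\vartheta_n=\tfrac{2\pi}{\lambda_c}\Big(\big(nd\sin\bar\theta+\tfrac{n^2d^2}{2}\tfrac{\sin2\bar\theta}{\bar d}\big)\Delta\theta-\tfrac{n^2d^2}{2}\tfrac{\sin^2\bar\theta}{\bar d^2}\Delta d\Big),$$ and assume $\beta_{\mathbf a}>0$. For a Hermitian matrix $\mathbf Z$ let $\mathbf C(\mathbf Z)^{-1}=\mathbf C_0^{-1}+\mathbf G^T\mathrm{diag}(\gamma/a_\tau^2,\gamma/a_\nu^2,\gamma/a_\theta^2)\mathbf G$, where $a_\tau,a_\nu,a_\theta>0$, $\mathbf G$ is the Jacobian at $\bar{\mathbf s}$ of $(\theta,r,v_x,v_y)\mapsto(2r/c,\,-\tfrac2{\lambda_c}(v_x\cos\theta+v_y\sin\theta),\,\theta)$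 ($c$ the speed of light) and $\gamma=\alpha^2\beta^2 G_sN\,\bar{\mathbf a}^H\mathbf Z\bar{\mathbf a}/(\bar d^4\sigma_s^2)$ with radar cross-section $\beta$, number of sensing symbols $G_s$ and echo noise power $\sigma_s^2>0$. **Feasible sets.** $\Psi$ collects $\mathbf W_k,\mathbf Z,\overline{\mathbf W}_k,\overline{\mathbf Z}_k$, $\overline{\mathbf W}_{kk'}$ ($k'\ne k$) and $\kappa_{1,k},\kappa_{2,k},\eta_k,\zeta_m\ge0$ ($1\le k,k'\le K$, $1\le m\le4$). $\mathcal F_\Psi$ is the set of all $\Psi$ with, for all $k\neq k'$ and all $m$ ($\mathbf q_m$ the $m$-th unit vector), $$\begin{bmatrix}\kappa_{1,k}\mathbf I&0\\0&-\kappa_{1,k}\beta_{\mathbf a}+\eta_k\end{bmatrix}-\mathbf U^H(\overline{\mathbf W}_k-\tilde R_{{\rm leak},k}\mathbf Z)\mathbf U\succeq0,\qquad \begin{bmatrix}\kappa_{2,k}+1&\bar d\\\bar d&-\kappa_{2,k}\beta_d+\bar d^2-\frac{\alpha\eta_k}{\tilde R_{{\rm leak},k}\sigma_{\rm E}^2}\end{bmatrix}\succeq0,$$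 $$\begin{bmatrix}\mathbf C(\mathbf Z)^{-1}&\mathbf q_m\\\mathbf q_m^T&\zeta_m\end{bmatrix}\succeq0,\quad \sum_m\zeta_m\le\Gamma_2,\quad 0\preceq\overline{\mathbf W}_k\preceq\mathbf W_k,\quad 0\preceq\overline{\mathbf Z}_k\preceq\mathbf Z,\quad 0\preceq\overline{\mathbf W}_{kk'}\preceq\mathbf W_{k'}.$$ $\mathcal F_\Psi^{P}$ is the set of those $\Psi\in\mathcal F_\Psi$ with $\mathbf W_k\preceq P_{\max}\mathbf I$ for all $k$ and $\mathbf Z\preceq P_{\max}\mathbf I$. Further $\mathcal F_{\mathbf e}=\{\mathbf e\in\{0,1\}^K:\sum_ke_k\ge\Gamma_1\}$. The coupling constraints are, for all $k\ne k'$, $$\mathrm{Tr}(\mathbf H_k\overline{\mathbf W}_k)-\tilde R_k\sum_{k'\ne k}\mathrm{Tr}(\mathbf H_k\overline{\mathbf W}_{kk'})-\tilde R_k\mathrm{Tr}(\mathbf H_k\overline{\mathbf Z}_k)-\tilde R_k\sigma_k^2e_k\ge0,$$ $$\overline{\mathbf W}_k\preceq e_kP_{\max}\mathbf I,\quad \overline{\mathbf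 W}_k\succeq\mathbf W_k-(1-e_k)P_{\max}\mathbf I,\quad \overline{\mathbf Z}_k\preceq e_kP_{\max}\mathbf I,\quad \overline{\mathbf Z}_k\succeq\mathbf Z-(1-e_k)P_{\max}\mathbf I,$$ $$\overline{\mathbf W}_{kk'}\preceq e_kP_{\max}\mathbf I,\quad \overline{\mathbf W}_{kk'}\preceq e_{k'}P_{\max}\mathbf I,\quad \overline{\mathbf W}_{kk'}\succeq\mathbf W_{k'}-(2-e_k-e_{k'})P_{\max}\mathbf I.$$ $\mathcal E$ is the set of $\mathbf e\in\mathbb R^K$ for which some $\Psi\in\mathcal F_\Psi$ satisfies them, and $g(\mathbf e)$ is the infimum of $p(\Psi)=\sum_k\mathrm{Tr}(\overline{\mathbf W}_k)+\mathrm{Tr}(\mathbf Z)$ over these $\Psi$ ($+\infty$ if there are none). The master problem is to minimise $g(\mathbf e)$ over $\mathbf e\in\mathcal F_{\mathbf e}\cap\mathcal E$. **Lagrangians.** A dual variable $\Pi=(\lambda_k,\Lambda_{1,k},\dots,\Lambda_{4,k},\Lambda_{5,kk'},\Lambda_{6,kk'},\Lambda_{7,kk'})_{k\ne k'}$ has a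 multiplier for each coupling constraint, in the order above; $\mathcal F_\Pi$ is the set of those with all $\lambda_k\ge0$ and all $\Lambda\succeq0$. Let $\overline{\mathcal L}(\Psi,\mathbf e,\Pi)$ be the sum of the multipliers times the constraint functions, each constraint written as "$\cdots\le0$" or "$\cdots\preceq0$" and matrices being paired by the trace, and $\mathcal L=p+\overline{\mathcal L}$. For $\mathcal F\in\{\mathcal F_\Psi,\mathcal F_\Psi^P\}$ put $\xi_{\mathcal F}(\mathbf e,\Pi)=\inf_{\Psi\in\mathcal F}\mathcal L(\Psi,\mathbf e,\Pi)$ and $\overline\xi_{\mathcal F}(\mathbf e,\Pi)=\inf_{\Psi\in\mathcal F}\overline{\mathcal L}(\Psi,\mathbf e,\Pi)$ in $[-\infty,\infty]$, and consider the cut problem $$\min_{\mathbf e\in\mathcal F_{\mathbf e},\ \mu\in\mathbb R}\mu\quad\text{s.t.}\quad \xi_{\mathcal F}(\mathbf e,\Pi)\le\mu\ \ \forall\,\Pi\in\mathcal F_\Pi,\qquad \overline\xi_{\mathcal F}(\mathbf e,\overline\Pi)\le0\ \ \forall\,\overline\Pi\in\mathcal F_\Pi\text{ with }\sum_k\overline\lambda_k=1.$$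 **Claim.** For both choices of $\mathcal F$ the master problem and the cut problem are equivalent: 1. $\mathbf e\in\mathcal F_{\mathbf e}$ belongs to $\mathcal E$ if and only if it satisfies all the feasibility cuts $\overline\xi_{\mathcal F}(\mathbf e,\overline\Pi)\le0$; 2. $g(\mathbf e)=\sup_{\Pi\in\mathcal F_\Pi}\xi_{\mathcal F}(\mathbf e,\Pi)$ for $\mathbf e\in\mathcal F_{\mathbf e}\cap\mathcal E$; 3. $(\mathbf e,\mu)$ is feasible for the cut problem if and only if $\mathbf e\in\mathcal F_{\mathbf e}\cap\mathcal E$ and $g(\mathbf e)\le\mu$; 4. the two problems have the same optimal value ($+\infty$ if infeasible); 5. $\mathbf e$ is optimal for the master problem if and only if $(\mathbf e,\mu)$ is optimal for the cut problem for some $\mu$, and then $\mu=g(\mathbf e)$. Moreover, if $\mathcal F_\Psi^P\ne\emptyset$, then for $\mathcal F=\mathcal F_\Psi^P$ the infima $\xi_{\mathcal F}(\mathbf e,\Pi)$ and $\overline\xi_{\mathcal F}(\mathbf e,\Pi)$ are attained (minima) for all $\mathbf e\in\mathcal F_{\mathbf e}$ and $\Pi\in\mathcal F_\Pi$. -/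

import Mathlib

open scoped ComplexOrder

noncomputable section

namespace SecureNF

/-- Complex `N × N` matrices with `N = 2 * M + 1` antennas. -/
abbrev CMat (M : ℕ) : Type := Matrix (Fin (2 * M + 1)) (Fin (2 * M + 1)) ℂ

/-- Data of the system in one time slot: `K` users, `N = 2 * M + 1` antennas. The state of the
eavesdropper is the vector `(angle, distance, v_x, v_y)`. -/
structure System (K M : ℕ) where
  /-- carrier wavelength -/
  lamC : ℝ
  /-- antenna spacing -/
  spacing : ℝ
  /-- speed of light -/
  c : ℝ
  /-- angles of the users -/
  angle : Fin K → ℝ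
  /-- distances of the users -/
  dist : Fin K → ℝ
  /-- noise powers (variances) at the users -/
  noise : Fin K → ℝ
  /-- noise power (variance) at the eavesdropper -/
  noiseE : ℝ
  /-- noise power (variance) of the sensing echoes at the base station -/
  noiseS : ℝ
  /-- radar cross-section of the eavesdropper -/
  rcs : ℝ
  /-- number of sensing symbols in the time slot -/
  nSym : ℕ
  /-- the constants relating delay, Doppler and angle measurement variances to the echo SNR -/
  aMeas : Fin 3 → ℝ
  /-- predicted state of the eavesdropper -/
  sPred : Fin 4 → ℝ
  /-- covariance matrix of the predicted state -/
  covPred : Matrix (Fin 4) (Fin 4) ℝ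
  /-- rate requirements of the users -/
  rateInfo : Fin K → ℝ
  /-- leakage rate limits -/
  rateLeak : Fin K → ℝ
  /-- the power constant of the big-M constraints -/
  Pmax : ℝ
  /-- threshold on the number of served users -/
  Gam1 : ℝ
  /-- threshold on the tracking error -/
  Gam2 : ℝ
  lamC_pos : 0 < lamC
  spacing_pos : 0 < spacing
  c_pos : 0 < c
  dist_pos : ∀ k, 0 < dist k
  noise_pos : ∀ k, 0 < noise k
  noiseE_pos : 0 < noiseE
  noiseS_pos : 0 < noiseS
  aMeas_pos : ∀ i, 0 < aMeas i
  dPred_pos : 0 < sPred 1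
  covPred_posDef : covPred.PosDef
  rateInfo_nonneg : ∀ k, 0 ≤ rateInfo k
  rateLeak_pos : ∀ k, 0 < rateLeak k
  Pmax_pos : 0 < Pmax

namespace System

variable {K M : ℕ} (S : System K M)

/-- `α = (λ_c / 4π)²`. -/
def alpha : ℝ := (S.lamC / (4 * Real.pi)) ^ 2

/-- The signed antenna index `n ∈ {-M, …, M}`. -/
def antenna (i : Fin (2 * M + 1)) : ℝ := (i : ℝ) - (M : ℝ)

/-- Near-field array response vector `a(θ, r)`. -/
def steer (θ r : ℝ) : Fin (2 * M + 1) → ℂ := fun i =>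
  Complex.exp (-Complex.I * ((2 * Real.pi / S.lamC *
    (-(antenna i * S.spacing * Real.cos θ)
      + antenna i ^ 2 * S.spacing ^ 2 * Real.sin θ ^ 2 / (2 * r)) : ℝ) : ℂ))

/-- Channel vector of user `k`. -/
def chan (k : Fin K) : Fin (2 * M + 1) → ℂ :=
  ((Real.sqrt S.alpha / S.dist k : ℝ) : ℂ) • S.steer (S.angle k) (S.dist k)

/-- `H_k = h_k h_kᴴ`. -/
def H (k : Fin K) : CMat M := Matrix.vecMulVec (S.chan k) (star (S.chan k))

/-- `2 ^ R - 1` for the rate requirement of user `k`. -/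
def rInfo (k : Fin K) : ℝ := (2 : ℝ) ^ S.rateInfo k - 1

/-- `2 ^ R - 1` for the leakage limit of user `k`. -/
def rLeak (k : Fin K) : ℝ := (2 : ℝ) ^ S.rateLeak k - 1

/-- Predicted angle of the eavesdropper. -/
def thetaBar : ℝ := S.sPred 0

/-- Predicted distance of the eavesdropper. -/
def dBar : ℝ := S.sPred 1

/-- Predicted array response `ā` towards the eavesdropper. -/
def aBar : Fin (2 * M + 1) → ℂ := S.steer S.thetaBar S.dBar

/-- Linearized phase error at antenna `i` for angle error `Δθ` and distance error `Δd`. -/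
def phaseErr (i : Fin (2 * M + 1)) (Δθ Δd : ℝ) : ℝ :=
  2 * Real.pi / S.lamC *
    ((antenna i * S.spacing * Real.sin S.thetaBar
        + antenna i ^ 2 * S.spacing ^ 2 / 2 * (Real.sin (2 * S.thetaBar) / S.dBar)) * Δθ
      - antenna i ^ 2 * S.spacing ^ 2 / 2 * (Real.sin S.thetaBar ^ 2 / S.dBar ^ 2) * Δd)

/-- The approximation `φ̂ = N - (1/2) ∑ ϑ²`. -/
def phiHat (Δθ Δd : ℝ) : ℝ :=
  ((2 * M + 1 : ℕ) : ℝ) - 1 / 2 * ∑ i : Fin (2 * M + 1), S.phaseErr i Δθ Δd ^ 2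

/-- Squared radius `β_a` of the uncertainty ball of the array response: the maximum of `2N - 2φ̂`
over the three-sigma box (a compact set, on which `φ̂` is continuous). -/
def betaA : ℝ :=
  sSup {x : ℝ | ∃ Δθ Δd : ℝ, |Δθ| ≤ 3 * Real.sqrt (S.covPred 0 0) ∧
    |Δd| ≤ 3 * Real.sqrt (S.covPred 1 1) ∧
    x = 2 * ((2 * M + 1 : ℕ) : ℝ) - 2 * S.phiHat Δθ Δd}

/-- Squared radius `β_d` of the uncertainty interval of the distance. -/
def betaD : ℝ := 9 * S.covPred 1 1

/-- Noise-free measurement (delay, Doppler frequency, angle) of a state. -/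
def meas (s : Fin 4 → ℝ) : Fin 3 → ℝ :=
  ![2 * s 1 / S.c,
    -(2 / S.lamC) * (s 2 * Real.cos (s 0) + s 3 * Real.sin (s 0)),
    s 0]

/-- Jacobian of the measurement function at the predicted state. -/
def jac : Matrix (Fin 3) (Fin 4) ℝ :=
  Matrix.of fun i j => fderiv ℝ S.meas S.sPred (Pi.single j 1) i

/-- SNR of the sensing echoes for the sensing covariance `Z`. -/
def snr (Z : CMat M) : ℝ :=
  S.alpha ^ 2 * S.rcs ^ 2 * (S.nSym : ℝ) * ((2 * M + 1 : ℕ) : ℝ)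
    * (star S.aBar ⬝ᵥ Z.mulVec S.aBar).re / (S.dBar ^ 4 * S.noiseS)

/-- Inverse `C⁻¹` of the posterior covariance matrix of the state, as a function of `Z`; the
measurement variances are `a_i² / γ`, so the inverse of their diagonal matrix is
`diag (γ / a_i²)`. -/
def covInv (Z : CMat M) : Matrix (Fin 4) (Fin 4) ℝ :=
  S.covPred⁻¹ + S.jac.transpose * Matrix.diagonal (fun i => S.snr Z / S.aMeas i ^ 2) * S.jac

end System

/-- The continuous variables `(W_k, Z, W̄_k, Z̄_k, W̄_{kk'}, κ_{1,k}, κ_{2,k}, η_k, ζ_m)`;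
`W̄_{kk'}` exists for `k' ≠ k` only. -/
abbrev Psi (K M : ℕ) : Type :=
  (Fin K → CMat M) × CMat M × (Fin K → CMat M) × (Fin K → CMat M) ×
    ((k : Fin K) → {k' : Fin K // k' ≠ k} → CMat M) ×
    (Fin K → ℝ) × (Fin K → ℝ) × (Fin K → ℝ) × (Fin 4 → ℝ)

namespace Psi

variable {K M : ℕ} (ψ : Psi K M)

/-- `W_k` -/
def W : Fin K → CMat M := ψ.1
/-- `Z` -/
def Z : CMat M := ψ.2.1
/-- `W̄_k` -/
def Wb : Fin K → CMat M := ψ.2.2.1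
/-- `Z̄_k` -/
def Zb : Fin K → CMat M := ψ.2.2.2.1
/-- `W̄_{kk'}`, `k' ≠ k` -/
def Wp : (k : Fin K) → {k' : Fin K // k' ≠ k} → CMat M := ψ.2.2.2.2.1
/-- `κ_{1,k}` -/
def kap1 : Fin K → ℝ := ψ.2.2.2.2.2.1
/-- `κ_{2,k}` -/
def kap2 : Fin K → ℝ := ψ.2.2.2.2.2.2.1
/-- `η_k` -/
def eta : Fin K → ℝ := ψ.2.2.2.2.2.2.2.1
/-- `ζ_m` -/
def zeta : Fin 4 → ℝ := ψ.2.2.2.2.2.2.2.2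

end Psi

/-- The dual variables: `lam k ≥ 0` for the rate constraints, `L1`, `L2` for C7a, C7b, `L3`, `L4`
for C8a, C8b and `L5`, `L6`, `L7` for C9a, C9b, C9c. -/
structure Dual (K M : ℕ) where
  lam : Fin K → ℝ
  L1 : Fin K → CMat M
  L2 : Fin K → CMat M
  L3 : Fin K → CMat M
  L4 : Fin K → CMat M
  L5 : (k : Fin K) → {k' : Fin K // k' ≠ k} → CMat M
  L6 : (k : Fin K) → {k' : Fin K // k' ≠ k} → CMat M
  L7 : (k : Fin K) → {k' : Fin K // k' ≠ k} → CMat M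

/-- The set of admissible dual variables (used for both Lagrangians). -/
def dualSet (K M : ℕ) : Set (Dual K M) :=
  {D | (∀ k, 0 ≤ D.lam k) ∧
    (∀ k, (D.L1 k).PosSemidef ∧ (D.L2 k).PosSemidef ∧ (D.L3 k).PosSemidef ∧
      (D.L4 k).PosSemidef) ∧
    (∀ k k', (D.L5 k k').PosSemidef ∧ (D.L6 k k').PosSemidef ∧ (D.L7 k k').PosSemidef)}

/-- Real part of the trace (the trace is real wherever it is used on Hermitian data). -/
def tr {M : ℕ} (A : CMat M) : ℝ := A.trace.re

namespace System

variable {K M : ℕ} (S : System K M)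

/-- `U = [I_N  ā]`. -/
def U : Matrix (Fin (2 * M + 1)) (Fin (2 * M + 1) ⊕ Unit) ℂ :=
  Matrix.fromCols 1 (Matrix.replicateCol Unit S.aBar)

/-- The matrix of the linear matrix inequality C2a for user `k`. -/
def lmiLeak (ψ : Psi K M) (k : Fin K) :
    Matrix (Fin (2 * M + 1) ⊕ Unit) (Fin (2 * M + 1) ⊕ Unit) ℂ :=
  Matrix.fromBlocks ((ψ.kap1 k : ℂ) • (1 : CMat M)) 0 0
      (Matrix.of fun _ _ => ((-(ψ.kap1 k) * S.betaA + ψ.eta k : ℝ) : ℂ))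
    - S.U.conjTranspose * (ψ.Wb k - (S.rLeak k : ℂ) • ψ.Z) * S.U

/-- The matrix of the linear matrix inequality C2b for user `k`. -/
def lmiDist (ψ : Psi K M) (k : Fin K) : Matrix (Fin 2) (Fin 2) ℝ :=
  !![ψ.kap2 k + 1, S.dBar;
     S.dBar, -(ψ.kap2 k) * S.betaD + S.dBar ^ 2 - S.alpha * ψ.eta k / (S.rLeak k * S.noiseE)]

/-- The matrix of the linear matrix inequality C5a for the state component `m`. -/
def lmiTrack (ψ : Psi K M) (m : Fin 4) : Matrix (Fin 4 ⊕ Unit) (Fin 4 ⊕ Unit) ℝ :=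
  Matrix.fromBlocks (S.covInv ψ.Z) (Matrix.replicateCol Unit (Pi.single m 1))
    (Matrix.replicateRow Unit (Pi.single m 1)) (Matrix.of fun _ _ => ψ.zeta m)

/-- The set `F_Ψ`: the constraints C2a, C2b, C5a, C5b, C7c-d, C8c-d, C9d-e, which involve the
continuous variables only, and the signs of the auxiliary variables. -/
def FPsi : Set (Psi K M) :=
  {ψ | (∀ k, 0 ≤ ψ.kap1 k ∧ 0 ≤ ψ.kap2 k ∧ 0 ≤ ψ.eta k) ∧ (∀ m, 0 ≤ ψ.zeta m) ∧
    (∀ k, (S.lmiLeak ψ k).PosSemidef) ∧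
    (∀ k, (S.lmiDist ψ k).PosSemidef) ∧
    (∀ m, (S.lmiTrack ψ m).PosSemidef) ∧
    ∑ m, ψ.zeta m ≤ S.Gam2 ∧
    (∀ k, (ψ.W k - ψ.Wb k).PosSemidef ∧ (ψ.Wb k).PosSemidef) ∧
    (∀ k, (ψ.Z - ψ.Zb k).PosSemidef ∧ (ψ.Zb k).PosSemidef) ∧
    (∀ k k', (ψ.W k'.1 - ψ.Wp k k').PosSemidef ∧ (ψ.Wp k k').PosSemidef)}

/-- The part of `F_Ψ` that respects the power limits `W_k ⪯ P_max I` and `Z ⪯ P_max I`. -/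
def FPsiPow : Set (Psi K M) :=
  {ψ | ψ ∈ S.FPsi ∧ (∀ k, ((S.Pmax : ℂ) • (1 : CMat M) - ψ.W k).PosSemidef) ∧
    ((S.Pmax : ℂ) • (1 : CMat M) - ψ.Z).PosSemidef}

/-- The set `F_e`: binary scheduling vectors that serve at least `Γ₁` users. -/
def Fe : Set (Fin K → ℝ) :=
  {e | (∀ k, e k = 0 ∨ e k = 1) ∧ S.Gam1 ≤ ∑ k, e k}

/-- The constraints that couple the continuous and the binary variables: the rate constraint C1,
and C7a-b, C8a-b, C9a-c. -/
def Coupling (ψ : Psi K M) (e : Fin K → ℝ) : Prop :=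
  (∀ k, 0 ≤ tr (S.H k * ψ.Wb k) - S.rInfo k * ∑ k', tr (S.H k * ψ.Wp k k')
      - S.rInfo k * tr (S.H k * ψ.Zb k) - S.rInfo k * S.noise k * e k) ∧
  (∀ k, (((e k * S.Pmax : ℝ) : ℂ) • (1 : CMat M) - ψ.Wb k).PosSemidef) ∧
  (∀ k, (ψ.Wb k - (ψ.W k - (((1 - e k) * S.Pmax : ℝ) : ℂ) • (1 : CMat M))).PosSemidef) ∧
  (∀ k, (((e k * S.Pmax : ℝ) : ℂ) • (1 : CMat M) - ψ.Zb k).PosSemidef) ∧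
  (∀ k, (ψ.Zb k - (ψ.Z - (((1 - e k) * S.Pmax : ℝ) : ℂ) • (1 : CMat M))).PosSemidef) ∧
  (∀ k k', (((e k * S.Pmax : ℝ) : ℂ) • (1 : CMat M) - ψ.Wp k k').PosSemidef) ∧
  (∀ k k', (((e k'.1 * S.Pmax : ℝ) : ℂ) • (1 : CMat M) - ψ.Wp k k').PosSemidef) ∧
  (∀ k k', (ψ.Wp k k'
    - (ψ.W k'.1 - (((2 - e k - e k'.1) * S.Pmax : ℝ) : ℂ) • (1 : CMat M))).PosSemidef)

end System

/-- The objective: the transmit power `∑ Tr W̄_k + Tr Z`. -/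
def power {K M : ℕ} (ψ : Psi K M) : ℝ := (∑ k, tr (ψ.Wb k)) + tr ψ.Z

namespace System

variable {K M : ℕ} (S : System K M)

/-- The set `𝓔` of the scheduling vectors for which the primal problem is feasible. -/
def feasE : Set (Fin K → ℝ) := {e | ∃ ψ ∈ S.FPsi, S.Coupling ψ e}

/-- `g(e)`: the optimal value of the primal problem (`⊤` if it is infeasible). -/
def g (e : Fin K → ℝ) : EReal :=
  ⨅ ψ ∈ {ψ : Psi K M | ψ ∈ S.FPsi ∧ S.Coupling ψ e}, ((power ψ : ℝ) : EReal)

/-- The part `h₁` of the Lagrangian that contains the continuous variables. -/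
def h1 (ψ : Psi K M) (D : Dual K M) : ℝ :=
  (∑ k, D.lam k * (S.rInfo k * tr (S.H k * ψ.Zb k)
      + S.rInfo k * ∑ k', tr (S.H k * ψ.Wp k k') - tr (S.H k * ψ.Wb k)))
  + (∑ k, (tr (D.L1 k * ψ.Wb k) + tr (D.L2 k * (ψ.W k - ψ.Wb k))
      + tr (D.L3 k * ψ.Zb k) + tr (D.L4 k * (ψ.Z - ψ.Zb k))))
  + ∑ k, ∑ k', (tr (D.L5 k k' * ψ.Wp k k') + tr (D.L6 k k' * ψ.Wp k k')
      + tr (D.L7 k k' * (ψ.W k'.1 - ψ.Wp k k')))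

/-- The part `h₂` of the Lagrangian that contains the binary variables. -/
def h2 (e : Fin K → ℝ) (D : Dual K M) : ℝ :=
  (∑ k, D.lam k * S.rInfo k * S.noise k * e k)
  - (∑ k, S.Pmax * (e k * tr (D.L1 k) + (1 - e k) * tr (D.L2 k)
      + e k * tr (D.L3 k) + (1 - e k) * tr (D.L4 k)))
  + ∑ k, ∑ k' : {k' : Fin K // k' ≠ k},
      S.Pmax * (-(e k) * tr (D.L5 k k') - e k'.1 * tr (D.L6 k k')
        - (2 - e k - e k'.1) * tr (D.L7 k k'))

/-- The partial Lagrangian of the primal problem. -/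
def lagr (ψ : Psi K M) (e : Fin K → ℝ) (D : Dual K M) : ℝ :=
  power ψ + S.h1 ψ D + S.h2 e D

/-- The partial Lagrangian of the feasibility problem. -/
def lagrBar (ψ : Psi K M) (e : Fin K → ℝ) (D : Dual K M) : ℝ :=
  S.h1 ψ D + S.h2 e D

/-- The support function `ξ`, over the set `F` of continuous variables. -/
def xi (F : Set (Psi K M)) (e : Fin K → ℝ) (D : Dual K M) : EReal :=
  ⨅ ψ ∈ F, ((S.lagr ψ e D : ℝ) : EReal)

/-- The support function `ξ̄`, over the set `F` of continuous variables. -/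
def xiBar (F : Set (Psi K M)) (e : Fin K → ℝ) (D : Dual K M) : EReal :=
  ⨅ ψ ∈ F, ((S.lagrBar ψ e D : ℝ) : EReal)

/-- `e` is optimal for the master problem: minimize `g` over `F_e ∩ 𝓔`. -/
def MasterOpt (e : Fin K → ℝ) : Prop :=
  e ∈ S.Fe ∩ S.feasE ∧ ∀ e' ∈ S.Fe ∩ S.feasE, S.g e ≤ S.g e'

/-- The optimality cuts C10. -/
def OptCuts (F : Set (Psi K M)) (e : Fin K → ℝ) (μ : ℝ) : Prop :=
  ∀ D ∈ dualSet K M, S.xi F e D ≤ (μ : EReal)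

/-- The feasibility cuts C11. -/
def FeasCuts (F : Set (Psi K M)) (e : Fin K → ℝ) : Prop :=
  ∀ D ∈ dualSet K M, ∑ k, D.lam k = 1 → S.xiBar F e D ≤ 0

/-- The feasible pairs `(e, μ)` of the problem with cuts. -/
def cutFeas (F : Set (Psi K M)) : Set ((Fin K → ℝ) × ℝ) :=
  {p | p.1 ∈ S.Fe ∧ S.OptCuts F p.1 p.2 ∧ S.FeasCuts F p.1}

/-- `(e, μ)` is optimal for the problem with cuts: minimize `μ`. -/
def CutOpt (F : Set (Psi K M)) (e : Fin K → ℝ) (μ : ℝ) : Prop :=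
  (e, μ) ∈ S.cutFeas F ∧ ∀ p ∈ S.cutFeas F, μ ≤ p.2

end System

end SecureNF

end

/-! The equivalence is Lagrangian duality without a gap for a convex conic program. No Slater point
is assumed; its role is played by compactness, and accordingly the supremum over the multipliers
need not be attained. Let `c` be a real number below the optimal value. At every point of `F` some
Lagrangian exceeds `c`: at a point satisfying the coupling constraints the zero multiplier does, and
at any other point a large multiple of a multiplier that detects a violation does
(`exists_lagrBar_pos`). One particular Lagrangian, that of `coerciveDual`, dominates the traces of
all `W_k` and of `Z`, and the matrix inequalities then bound the remaining variables, where `β_a >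
0` is needed for `κ_{1,k}`. Its sublevel sets are therefore compact, so finitely many Lagrangians
suffice for all of `F`. Separation in a finite-dimensional space replaces their maximum by a convex
combination, which is again a Lagrangian because the multipliers form a convex set
(`exists_forall_le_of_isCompact_sublevel`, `exists_dual_le`). With the power as objective this
yields the optimality cuts, with the zero objective the feasibility cuts. The coupling constraints
already imply the power limits, so restricting to `FPsiPow` loses no feasible point and one argument
serves both choices of `F`. -/

/-! ### Minimax by separation and compactness -/

/-- A finite family of convex functions whose maximum is bounded below by `c` on a convex set has a
convex combination that is bounded below by `c` on this set. -/
theorem exists_mem_stdSimplex_le_sum_of_convexOn {E ι : Type*} [AddCommGroup E] [Module ℝ E]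
    [Fintype ι] {F : Set E} (hF : Convex ℝ F) (hne : F.Nonempty) {φ : ι → E → ℝ}
    (hφ : ∀ i, ConvexOn ℝ F (φ i)) {c : ℝ} (h : ∀ x ∈ F, ∃ i, c ≤ φ i x) :
    ∃ w ∈ stdSimplex ℝ ι, ∀ x ∈ F, c ≤ ∑ i, w i * φ i x := by
  classical
  -- The open orthant below `c` is disjoint from the upward closure of the image of `F`; a
  -- separating functional gives the weights after normalization.
  set s : Set (ι → ℝ) := Set.univ.pi fun _ => Set.Iio c with hs
  set t : Set (ι → ℝ) := {y | ∃ x ∈ F, ∀ i, φ i x ≤ y i} with ht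
  have hsc : Convex ℝ s := convex_pi fun _ _ => convex_Iio c
  have hso : IsOpen s := isOpen_set_pi Set.finite_univ fun _ _ => isOpen_Iio
  have htc : Convex ℝ t := by
    rintro y ⟨x, hx, hxy⟩ y' ⟨x', hx', hxy'⟩ a b ha hb hab
    refine ⟨a • x + b • x', hF hx hx' ha hb hab, fun i => ?_⟩
    refine ((hφ i).2 hx hx' ha hb hab).trans ?_
    simp only [smul_eq_mul, Pi.add_apply, Pi.smul_apply]
    gcongr
    exacts [hxy i, hxy' i]
  have hdisj : Disjoint s t := by
    rw [Set.disjoint_left]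
    rintro y hy ⟨x, hx, hxy⟩
    obtain ⟨i, hi⟩ := h x hx
    exact absurd (hi.trans (hxy i)) (not_le.2 (hy i trivial))
  obtain ⟨f, u, hfs, hft⟩ := geometric_hahn_banach_open hsc hso htc hdisj
  set v : ι → ℝ := fun i => f (Pi.single i 1) with hv
  have hf : ∀ y, f y = ∑ i, v i * y i := fun y => by
    conv_lhs => rw [pi_eq_sum_univ' y]
    simp only [map_sum, map_smul, smul_eq_mul, hv]
    refine Finset.sum_congr rfl fun i _ => ?_
    rw [mul_comm]
  obtain ⟨x₀, hx₀⟩ := hne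
  -- `t` is upward closed, so a negative coefficient would make `f` unbounded below on `t`.
  have hv0 : ∀ i, 0 ≤ v i := by
    intro i
    by_contra hlt
    push Not at hlt
    set y₀ : ι → ℝ := fun j => φ j x₀
    obtain ⟨n, hn⟩ := exists_nat_gt ((f y₀ - u) / (-v i))
    have h1 := hft (y₀ + Pi.single i (n : ℝ)) ⟨x₀, hx₀, fun j => by
      have : (0 : ι → ℝ) ≤ Pi.single i (n : ℝ) := Pi.single_nonneg.2 n.cast_nonneg
      simpa [y₀] using this j⟩
    rw [map_add, show Pi.single i (n : ℝ) = (n : ℝ) • Pi.single i (1 : ℝ) by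
      simp [← Pi.single_smul], map_smul, smul_eq_mul] at h1
    rw [div_lt_iff₀ (by linarith)] at hn
    change u ≤ f y₀ + n * v i at h1
    linarith
  -- The constant vector `c` lies only on the boundary of `s`, so it is approached from inside; `δ`
  -- keeps the loss below `ε`.
  have hcu : (∑ i, v i) * c ≤ u := by
    refine le_of_forall_pos_lt_add fun ε hε => ?_
    set δ := ε / (∑ i, v i + 1)
    have hS : 0 ≤ ∑ i, v i := Finset.sum_nonneg fun i _ => hv0 i
    have hδ : 0 < δ := by positivity
    have h1 := hfs (fun _ => c - δ) fun i _ => by simpa using hδ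
    rw [hf, ← Finset.sum_mul] at h1
    have h2 : (∑ i, v i) * δ < ε := by
      have : (∑ i, v i + 1) * δ = ε := mul_div_cancel₀ _ (by positivity)
      nlinarith
    linarith
  have hpos : 0 < ∑ i, v i := by
    refine lt_of_le_of_ne (Finset.sum_nonneg fun i _ => hv0 i) fun h0 => ?_
    have hz : ∀ i, v i = 0 := fun i =>
      (Finset.sum_eq_zero_iff_of_nonneg fun i _ => hv0 i).1 h0.symm i (Finset.mem_univ i)
    have h1 := hfs (fun _ => c - 1) fun i _ => by simp
    have h2 := hft (fun i => φ i x₀) ⟨x₀, hx₀, fun i => le_rfl⟩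
    simp only [hf, hz, zero_mul, Finset.sum_const_zero] at h1 h2
    linarith
  refine ⟨fun i => v i / ∑ i, v i, ⟨fun i => div_nonneg (hv0 i) hpos.le, ?_⟩, fun x hx => ?_⟩
  · rw [← Finset.sum_div, div_self hpos.ne']
  · have h2 := hft (fun i => φ i x) ⟨x, hx, fun i => le_rfl⟩
    rw [hf] at h2
    simp only [div_mul_eq_mul_div]
    rw [← Finset.sum_div, le_div_iff₀ hpos]
    linarith

/-- Minimax principle for a convex set `Φ` of continuous convex functions, one of which has a
compact sublevel set. -/
theorem exists_forall_le_of_isCompact_sublevel {E : Type*} [AddCommGroup E] [Module ℝ E]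
    [TopologicalSpace E] {F : Set E} (hF : Convex ℝ F) {Φ : Set (E → ℝ)} (hΦ : Convex ℝ Φ)
    (hconv : ∀ φ ∈ Φ, ConvexOn ℝ F φ) (hcont : ∀ φ ∈ Φ, Continuous φ) {c : ℝ} {φ₀ : E → ℝ}
    (hφ₀ : φ₀ ∈ Φ) (hcpt : IsCompact {x ∈ F | φ₀ x ≤ c}) (h : ∀ x ∈ F, ∃ φ ∈ Φ, c < φ x) :
    ∃ φ ∈ Φ, ∀ x ∈ F, c ≤ φ x := by
  classical
  obtain rfl | hne := F.eq_empty_or_nonempty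
  · exact ⟨φ₀, hφ₀, by simp⟩
  -- Compactness handles only the sublevel set of `φ₀`. Elsewhere `φ₀` itself exceeds `c`, which is
  -- why it is added to the finite family.
  obtain ⟨T, hT⟩ := hcpt.elim_finite_subcover (fun φ : Φ => {x | c < φ.1 x})
    (fun φ => isOpen_lt continuous_const (hcont _ φ.2)) fun x hx => by
      obtain ⟨φ, hφ, hlt⟩ := h x hx.1
      exact Set.mem_iUnion.2 ⟨⟨φ, hφ⟩, hlt⟩
  set T' : Finset Φ := insert ⟨φ₀, hφ₀⟩ T
  obtain ⟨w, hw, hle⟩ := exists_mem_stdSimplex_le_sum_of_convexOn (ι := T') hF hne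
    (φ := fun i => i.1.1) (c := c) (fun i => hconv _ i.1.2) fun x hx => by
      by_cases hx0 : φ₀ x ≤ c
      · obtain ⟨φ, hφ, hlt⟩ := Set.mem_iUnion₂.1 (hT ⟨hx, hx0⟩)
        exact ⟨⟨φ, Finset.mem_insert_of_mem hφ⟩, le_of_lt hlt⟩
      · exact ⟨⟨⟨φ₀, hφ₀⟩, Finset.mem_insert_self _ _⟩, (not_le.1 hx0).le⟩
  refine ⟨∑ i : T', w i • i.1.1, hΦ.sum_mem (fun i _ => hw.1 i) hw.2 fun i _ => i.1.2,
    fun x hx => ?_⟩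
  simpa [Finset.sum_apply] using hle x hx

/-! ### The positive semidefinite cone and its self-duality -/

namespace Matrix

open scoped MatrixOrder

theorem convex_setOf_posSemidef {n 𝕜 : Type*} [RCLike 𝕜] :
    Convex ℝ {A : Matrix n n 𝕜 | A.PosSemidef} :=
  fun _ hA _ hB _ _ ha hb _ => (PosSemidef.smul hA ha).add (PosSemidef.smul hB hb)

variable {n 𝕜 : Type*} [Fintype n] [RCLike 𝕜]

theorem isClosed_setOf_posSemidef : IsClosed {A : Matrix n n 𝕜 | A.PosSemidef} := by
  simp only [posSemidef_iff_dotProduct_mulVec, Set.ofPred_and, Set.ofPred_forall]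
  refine IsClosed.inter ?_ (isClosed_iInter fun x => ?_)
  · exact isClosed_eq (by fun_prop) continuous_id
  · exact isClosed_le continuous_const (by fun_prop)

theorem PosSemidef.exists_eq_conjTranspose_mul_self [DecidableEq n] {A : Matrix n n 𝕜}
    (hA : A.PosSemidef) : ∃ C : Matrix n n 𝕜, A = Cᴴ * C :=
  CStarAlgebra.nonneg_iff_eq_star_mul_self.1 hA.nonneg

/-- Writing `A = Cᴴ C` turns the trace into that of `C B Cᴴ`, which is positive semidefinite. -/
theorem PosSemidef.re_trace_mul_nonneg [DecidableEq n] {A B : Matrix n n 𝕜} (hA : A.PosSemidef)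
    (hB : B.PosSemidef) : 0 ≤ RCLike.re (A * B).trace := by
  obtain ⟨C, rfl⟩ := hA.exists_eq_conjTranspose_mul_self
  rw [Matrix.mul_assoc, trace_mul_comm]
  have := (hB.mul_mul_conjTranspose_same C).trace_nonneg
  rw [Matrix.mul_assoc] at this ⊢
  exact (RCLike.nonneg_iff.1 this).1

/-- For `A = Cᴴ C` an entry is an inner product of columns of `C`, at most the mean of two diagonal
entries of `A`. Trace bounds thus become entrywise bounds. -/
theorem PosSemidef.norm_apply_le_re_trace [DecidableEq n] {A : Matrix n n 𝕜} (hA : A.PosSemidef)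
    (i j : n) : ‖A i j‖ ≤ RCLike.re A.trace := by
  obtain ⟨C, rfl⟩ := hA.exists_eq_conjTranspose_mul_self
  have hdiag : ∀ l, RCLike.re ((Cᴴ * C) l l) = ∑ k, ‖C k l‖ ^ 2 := fun l => by
    simp only [mul_apply, conjTranspose_apply, map_sum]
    refine Finset.sum_congr rfl fun k _ => ?_
    rw [RCLike.star_def, RCLike.conj_mul, ← RCLike.ofReal_pow, RCLike.ofReal_re]
  have hle : ∀ l, ∑ k, ‖C k l‖ ^ 2 ≤ RCLike.re (Cᴴ * C).trace := fun l => by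
    rw [trace, map_sum]
    simp only [diag_apply, hdiag]
    exact Finset.single_le_sum (f := fun l => ∑ k, ‖C k l‖ ^ 2) (fun _ _ => by positivity)
      (Finset.mem_univ l)
  have h2 : ‖(Cᴴ * C) i j‖ ≤ ∑ k, (‖C k i‖ ^ 2 + ‖C k j‖ ^ 2) / 2 := by
    rw [mul_apply]
    refine norm_sum_le_of_le _ fun k _ => ?_
    rw [norm_mul, conjTranspose_apply, norm_star]
    nlinarith [sq_nonneg (‖C k i‖ - ‖C k j‖)]
  rw [← Finset.sum_div, Finset.sum_add_distrib] at h2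
  linarith [hle i, hle j]

/-- If `A` is not positive semidefinite, a vector `x` with negative quadratic form gives `B = x xᴴ`;
otherwise `B = 0`. In this form one multiplier can be chosen for every constraint, violated or not,
with no contribution of the wrong sign. -/
theorem IsHermitian.exists_posSemidef_re_trace_mul [DecidableEq n] {A : Matrix n n 𝕜}
    (hA : A.IsHermitian) : ∃ B : Matrix n n 𝕜, B.PosSemidef ∧ RCLike.re (B * A).trace ≤ 0 ∧
      (RCLike.re (B * A).trace = 0 → A.PosSemidef) := by
  by_cases h : A.PosSemidef
  · exact ⟨0, .zero, by simp, fun _ => h⟩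
  · rw [posSemidef_iff_dotProduct_mulVec] at h
    push Not at h
    obtain ⟨x, hx⟩ := h hA
    have hlt : RCLike.re (star x ⬝ᵥ A *ᵥ x) < 0 := by
      by_contra! h0
      exact hx (RCLike.nonneg_iff.2 ⟨h0, hA.im_star_dotProduct_mulVec_self x⟩)
    have heq : (vecMulVec x (star x) * A).trace = star x ⬝ᵥ A *ᵥ x := by
      rw [vecMulVec_mul, trace_vecMulVec, dotProduct_comm, dotProduct_mulVec]
    refine ⟨vecMulVec x (star x), posSemidef_vecMulVec_self_star x, ?_, ?_⟩ <;> rw [heq]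
    · exact hlt.le
    · exact fun h0 => absurd h0 hlt.ne

end Matrix

/-! ### Convexity and closedness of the sets of continuous variables -/

noncomputable section

namespace SecureNF

variable {K M : ℕ}

theorem tr_add (A B : CMat M) : tr (A + B) = tr A + tr B := by simp [tr]

theorem tr_sub (A B : CMat M) : tr (A - B) = tr A - tr B := by simp [tr]

theorem tr_smul (a : ℝ) (A : CMat M) : tr (a • A) = a * tr A := by
  simp [tr, Matrix.trace_smul]

theorem tr_zero : tr (0 : CMat M) = 0 := by simp [tr]

@[fun_prop]
theorem continuous_tr : Continuous (tr : CMat M → ℝ) := by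
  unfold tr; fun_prop

theorem tr_nonneg {A : CMat M} (hA : A.PosSemidef) : 0 ≤ tr A :=
  (RCLike.nonneg_iff.1 hA.trace_nonneg).1

theorem tr_mul_nonneg {A B : CMat M} (hA : A.PosSemidef) (hB : B.PosSemidef) : 0 ≤ tr (A * B) :=
  hA.re_trace_mul_nonneg hB

namespace Psi

@[fun_prop] theorem continuous_W : Continuous (W : Psi K M → _) := by unfold W; fun_prop
@[fun_prop] theorem continuous_Z : Continuous (Z : Psi K M → _) := by unfold Z; fun_prop
@[fun_prop] theorem continuous_Wb : Continuous (Wb : Psi K M → _) := by unfold Wb; fun_prop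
@[fun_prop] theorem continuous_Zb : Continuous (Zb : Psi K M → _) := by unfold Zb; fun_prop
@[fun_prop] theorem continuous_Wp : Continuous (Wp : Psi K M → _) := by unfold Wp; fun_prop
@[fun_prop] theorem continuous_kap1 : Continuous (kap1 : Psi K M → _) := by unfold kap1; fun_prop
@[fun_prop] theorem continuous_kap2 : Continuous (kap2 : Psi K M → _) := by unfold kap2; fun_prop
@[fun_prop] theorem continuous_eta : Continuous (eta : Psi K M → _) := by unfold eta; fun_prop
@[fun_prop] theorem continuous_zeta : Continuous (zeta : Psi K M → _) := by unfold zeta; fun_prop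

variable (a b : ℝ) (x y : Psi K M)

theorem W_comb : (a • x + b • y).W = a • x.W + b • y.W := rfl
theorem Z_comb : (a • x + b • y).Z = a • x.Z + b • y.Z := rfl
theorem Wb_comb : (a • x + b • y).Wb = a • x.Wb + b • y.Wb := rfl
theorem Zb_comb : (a • x + b • y).Zb = a • x.Zb + b • y.Zb := rfl
theorem Wp_comb : (a • x + b • y).Wp = a • x.Wp + b • y.Wp := rfl
theorem kap1_comb : (a • x + b • y).kap1 = a • x.kap1 + b • y.kap1 := rfl
theorem kap2_comb : (a • x + b • y).kap2 = a • x.kap2 + b • y.kap2 := rfl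
theorem eta_comb : (a • x + b • y).eta = a • x.eta + b • y.eta := rfl
theorem zeta_comb : (a • x + b • y).zeta = a • x.zeta + b • y.zeta := rfl

end Psi

namespace System

variable (S : System K M)

theorem snr_comb (a b : ℝ) (Z Z' : CMat M) :
    S.snr (a • Z + b • Z') = a * S.snr Z + b * S.snr Z' := by
  unfold snr
  simp only [Matrix.add_mulVec, Matrix.smul_mulVec, dotProduct_add, dotProduct_smul,
    Complex.add_re, Complex.smul_re, smul_eq_mul]
  ring

/-- The prior term `C₀⁻¹` does not depend on `Z`, so the map is affine rather than linear; hence the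
condition `a + b = 1`. -/
theorem covInv_comb {a b : ℝ} (hab : a + b = 1) (Z Z' : CMat M) :
    S.covInv (a • Z + b • Z') = a • S.covInv Z + b • S.covInv Z' := by
  have hd : Matrix.diagonal (fun i => S.snr (a • Z + b • Z') / S.aMeas i ^ 2)
      = a • Matrix.diagonal (fun i => S.snr Z / S.aMeas i ^ 2)
        + b • Matrix.diagonal (fun i => S.snr Z' / S.aMeas i ^ 2) := by
    rw [← Matrix.diagonal_smul, ← Matrix.diagonal_smul, Matrix.diagonal_add]
    congr 1
    ext i
    simp only [snr_comb, Pi.smul_apply, smul_eq_mul]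
    ring
  obtain rfl : b = 1 - a := by linarith
  unfold covInv
  rw [hd]
  simp only [Matrix.mul_add, Matrix.add_mul, Matrix.mul_smul, Matrix.smul_mul]
  module

theorem lmiLeak_comb (a b : ℝ) (x y : Psi K M) (k : Fin K) :
    S.lmiLeak (a • x + b • y) k = a • S.lmiLeak x k + b • S.lmiLeak y k := by
  have h1 : S.U.conjTranspose * ((a • x + b • y).Wb k - (S.rLeak k : ℂ) • (a • x + b • y).Z) * S.U
      = a • (S.U.conjTranspose * (x.Wb k - (S.rLeak k : ℂ) • x.Z) * S.U)
        + b • (S.U.conjTranspose * (y.Wb k - (S.rLeak k : ℂ) • y.Z) * S.U) := by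
    have h0 : (a • x + b • y).Wb k - (S.rLeak k : ℂ) • (a • x + b • y).Z
        = a • (x.Wb k - (S.rLeak k : ℂ) • x.Z) + b • (y.Wb k - (S.rLeak k : ℂ) • y.Z) := by
      ext i j
      simp [Psi.Wb_comb, Psi.Z_comb]
      ring
    rw [h0, Matrix.mul_add, Matrix.add_mul, Matrix.mul_smul, Matrix.mul_smul, Matrix.smul_mul,
      Matrix.smul_mul]
  unfold lmiLeak
  rw [h1, smul_sub, smul_sub, Matrix.fromBlocks_smul, Matrix.fromBlocks_smul]
  rw [sub_add_sub_comm, Matrix.fromBlocks_add]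
  congr 2
  · ext i j
    simp [Psi.kap1_comb]
    ring
  · simp
  · simp
  · ext i j
    simp [Psi.kap1_comb, Psi.eta_comb]
    ring

theorem lmiDist_comb {a b : ℝ} (hab : a + b = 1) (x y : Psi K M) (k : Fin K) :
    S.lmiDist (a • x + b • y) k = a • S.lmiDist x k + b • S.lmiDist y k := by
  obtain rfl : b = 1 - a := by linarith
  unfold lmiDist
  ext i j
  fin_cases i <;> fin_cases j <;>
    simp [Psi.kap2_comb, Psi.eta_comb] <;> ring

theorem lmiTrack_comb {a b : ℝ} (hab : a + b = 1) (x y : Psi K M) (m : Fin 4) :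
    S.lmiTrack (a • x + b • y) m = a • S.lmiTrack x m + b • S.lmiTrack y m := by
  unfold lmiTrack
  rw [Matrix.fromBlocks_smul, Matrix.fromBlocks_smul, Matrix.fromBlocks_add, Psi.Z_comb,
    S.covInv_comb hab, Psi.zeta_comb, ← add_smul, ← add_smul, hab, one_smul, one_smul]
  rfl

theorem convex_FPsi : Convex ℝ S.FPsi := by
  rintro x ⟨hx1, hx2, hx3, hx4, hx5, hx6, hx7, hx8, hx9⟩ y
    ⟨hy1, hy2, hy3, hy4, hy5, hy6, hy7, hy8, hy9⟩ a b ha hb hab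
  have psd : ∀ {A B A' B' : CMat M}, (A - B).PosSemidef → (A' - B').PosSemidef →
      (a • A + b • A' - (a • B + b • B')).PosSemidef := fun h h' => by
    rw [add_sub_add_comm, ← smul_sub, ← smul_sub]
    exact Matrix.convex_setOf_posSemidef h h' ha hb hab
  refine ⟨fun k => ⟨?_, ?_, ?_⟩, fun m => ?_, fun k => ?_, fun k => ?_, fun m => ?_, ?_,
    fun k => ⟨psd (hx7 k).1 (hy7 k).1, ?_⟩, fun k => ⟨psd (hx8 k).1 (hy8 k).1, ?_⟩,
    fun k k' => ⟨psd (hx9 k k').1 (hy9 k k').1, ?_⟩⟩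
  · exact add_nonneg (mul_nonneg ha (hx1 k).1) (mul_nonneg hb (hy1 k).1)
  · exact add_nonneg (mul_nonneg ha (hx1 k).2.1) (mul_nonneg hb (hy1 k).2.1)
  · exact add_nonneg (mul_nonneg ha (hx1 k).2.2) (mul_nonneg hb (hy1 k).2.2)
  · exact add_nonneg (mul_nonneg ha (hx2 m)) (mul_nonneg hb (hy2 m))
  · rw [lmiLeak_comb]
    exact Matrix.convex_setOf_posSemidef (hx3 k) (hy3 k) ha hb hab
  · rw [S.lmiDist_comb hab]
    exact Matrix.convex_setOf_posSemidef (hx4 k) (hy4 k) ha hb hab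
  · rw [S.lmiTrack_comb hab]
    exact Matrix.convex_setOf_posSemidef (hx5 m) (hy5 m) ha hb hab
  · simp only [Psi.zeta_comb, Pi.add_apply, Pi.smul_apply, smul_eq_mul, Finset.sum_add_distrib,
      ← Finset.mul_sum]
    exact convex_Iic S.Gam2 hx6 hy6 ha hb hab
  · exact Matrix.convex_setOf_posSemidef (hx7 k).2 (hy7 k).2 ha hb hab
  · exact Matrix.convex_setOf_posSemidef (hx8 k).2 (hy8 k).2 ha hb hab
  · exact Matrix.convex_setOf_posSemidef (hx9 k k').2 (hy9 k k').2 ha hb hab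

theorem convex_FPsiPow : Convex ℝ S.FPsiPow := by
  rintro x ⟨hx, hxW, hxZ⟩ y ⟨hy, hyW, hyZ⟩ a b ha hb hab
  have psd : ∀ {A A' B : CMat M}, (B - A).PosSemidef → (B - A').PosSemidef →
      (B - (a • A + b • A')).PosSemidef := fun {A A' B} h h' => by
    have : B - (a • A + b • A') = a • (B - A) + b • (B - A') := by
      obtain rfl : b = 1 - a := by linarith
      module
    rw [this]
    exact Matrix.convex_setOf_posSemidef h h' ha hb hab
  exact ⟨S.convex_FPsi hx hy ha hb hab, fun k => psd (hxW k) (hyW k), psd hxZ hyZ⟩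

@[fun_prop]
theorem continuous_lmiLeak (k : Fin K) : Continuous fun ψ => S.lmiLeak ψ k := by
  unfold lmiLeak
  refine Continuous.sub (Continuous.matrix_fromBlocks ?_ ?_ ?_ ?_) ?_
  · fun_prop
  · fun_prop
  · fun_prop
  · exact continuous_matrix fun i j => by simp only [Matrix.of_apply]; fun_prop
  · fun_prop

@[fun_prop]
theorem continuous_lmiDist (k : Fin K) : Continuous fun ψ => S.lmiDist ψ k := by
  refine continuous_matrix fun i j => ?_
  fin_cases i <;> fin_cases j <;> simp [lmiDist] <;> fun_prop

@[fun_prop]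
theorem continuous_lmiTrack (m : Fin 4) : Continuous fun ψ => S.lmiTrack ψ m := by
  unfold lmiTrack covInv snr
  refine Continuous.matrix_fromBlocks ?_ ?_ ?_ ?_
  · fun_prop
  · fun_prop
  · fun_prop
  · exact continuous_matrix fun i j => by simp only [Matrix.of_apply]; fun_prop

theorem isClosed_FPsi : IsClosed S.FPsi := by
  have psd : ∀ {n 𝕜 : Type} [Fintype n] [RCLike 𝕜] {f : Psi K M → Matrix n n 𝕜}, Continuous f →
      IsClosed {ψ | (f ψ).PosSemidef} := fun hf => Matrix.isClosed_setOf_posSemidef.preimage hf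
  simp only [FPsi, Set.ofPred_and, Set.ofPred_forall]
  refine IsClosed.inter (isClosed_iInter fun k => ?_) <| IsClosed.inter (isClosed_iInter fun m => ?_)
    <| IsClosed.inter (isClosed_iInter fun k => ?_) <| IsClosed.inter (isClosed_iInter fun k => ?_)
    <| IsClosed.inter (isClosed_iInter fun m => ?_) <| IsClosed.inter ?_
    <| IsClosed.inter (isClosed_iInter fun k => ?_) <| IsClosed.inter (isClosed_iInter fun k => ?_)
    (isClosed_iInter fun k => isClosed_iInter fun k' => ?_)
  · refine IsClosed.inter ?_ (IsClosed.inter ?_ ?_) <;>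
      exact isClosed_le continuous_const (by fun_prop)
  · exact isClosed_le continuous_const (by fun_prop)
  · exact psd (by fun_prop)
  · exact psd (by fun_prop)
  · exact psd (by fun_prop)
  · exact isClosed_le (by fun_prop) continuous_const
  · exact (psd (by fun_prop)).inter (psd (by fun_prop))
  · exact (psd (by fun_prop)).inter (psd (by fun_prop))
  · exact (psd (by fun_prop)).inter (psd (by fun_prop))

theorem isClosed_FPsiPow : IsClosed S.FPsiPow := by
  have psd : ∀ {f : Psi K M → CMat M}, Continuous f → IsClosed {ψ | (f ψ).PosSemidef} :=
    fun hf => Matrix.isClosed_setOf_posSemidef.preimage hf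
  simp only [FPsiPow, Set.ofPred_and, Set.ofPred_forall]
  exact IsClosed.inter S.isClosed_FPsi <| IsClosed.inter
    (isClosed_iInter fun k => psd (by fun_prop)) (psd (by fun_prop))

end System

/-! ### Compactness from trace bounds -/

/-- The matrices whose entries are bounded by `R`. -/
def entryBall (M : ℕ) (R : ℝ) : Set (CMat M) :=
  Set.univ.pi fun _ => Set.univ.pi fun _ => Metric.closedBall 0 R

theorem isCompact_entryBall (R : ℝ) : IsCompact (entryBall M R) :=
  isCompact_univ_pi fun _ => isCompact_univ_pi fun _ => isCompact_closedBall 0 R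

theorem mem_entryBall {A : CMat M} (hA : A.PosSemidef) {R : ℝ} (h : tr A ≤ R) :
    A ∈ entryBall M R := fun i _ j _ => by
  simpa using (hA.norm_apply_le_re_trace i j).trans h

theorem mem_entryBall_of_le {A B : CMat M} (hA : A.PosSemidef) (hBA : (B - A).PosSemidef) {R : ℝ}
    (h : tr B ≤ R) : A ∈ entryBall M R :=
  mem_entryBall hA <| by
    have := tr_nonneg hBA
    rw [tr_sub] at this
    linarith

namespace System

variable (S : System K M)

theorem alpha_pos : 0 < S.alpha := by
  have := S.lamC_pos
  unfold alpha
  positivity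

theorem rLeak_pos (k : Fin K) : 0 < S.rLeak k :=
  sub_pos.2 (Real.one_lt_rpow one_lt_two (S.rateLeak_pos k))

theorem rInfo_nonneg (k : Fin K) : 0 ≤ S.rInfo k :=
  sub_nonneg.2 (Real.one_le_rpow one_le_two (S.rateInfo_nonneg k))

theorem betaD_pos : 0 < S.betaD := mul_pos (by norm_num) S.covPred_posDef.diag_pos

variable {S} {ψ : Psi K M}

theorem W_posSemidef (hψ : ψ ∈ S.FPsi) (k : Fin K) : (ψ.W k).PosSemidef := by
  obtain ⟨-, -, -, -, -, -, h, -, -⟩ := hψ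
  simpa using (h k).1.add (h k).2

/-- This is not imposed directly: `Z` is the sum of `Z - Z̄_k` and `Z̄_k`, for which one user must
exist. -/
theorem Z_posSemidef (hK : 0 < K) (hψ : ψ ∈ S.FPsi) : ψ.Z.PosSemidef := by
  obtain ⟨-, -, -, -, -, -, -, h, -⟩ := hψ
  simpa using (h ⟨0, hK⟩).1.add (h ⟨0, hK⟩).2

/-- The lower diagonal entry of the distance inequality is nonnegative and subtracts two nonnegative
terms from `d̄²`, so each of them is at most `d̄²`. -/
theorem kap2_eta_le (hψ : ψ ∈ S.FPsi) (k : Fin K) :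
    ψ.kap2 k ≤ S.dBar ^ 2 / S.betaD ∧
      ψ.eta k ≤ S.dBar ^ 2 * (S.rLeak k * S.noiseE) / S.alpha := by
  obtain ⟨h1, -, -, h4, -, -, -, -, -⟩ := hψ
  have h : 0 ≤ -(ψ.kap2 k) * S.betaD + S.dBar ^ 2 - S.alpha * ψ.eta k / (S.rLeak k * S.noiseE) := by
    simpa [lmiDist] using (h4 k).diag_nonneg (i := 1)
  have hα := S.alpha_pos
  have hr := mul_pos (S.rLeak_pos k) S.noiseE_pos
  have hk := mul_nonneg (h1 k).2.1 S.betaD_pos.le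
  have he : 0 ≤ S.alpha * ψ.eta k / (S.rLeak k * S.noiseE) :=
    div_nonneg (mul_nonneg hα.le (h1 k).2.2) hr.le
  constructor
  · rw [le_div_iff₀ S.betaD_pos]
    linarith
  · rw [le_div_iff₀ hα, ← div_le_iff₀ hr, mul_comm]
    linarith

/-- This is the nonnegativity of the corner entry of the leakage inequality. Once the covariances
are bounded, division by `β_a > 0` bounds `κ_{1,k}`. -/
theorem kap1_mul_betaA_le (hψ : ψ ∈ S.FPsi) (k : Fin K) :
    ψ.kap1 k * S.betaA ≤ ψ.eta k - ((S.U.conjTranspose *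
      (ψ.Wb k - (S.rLeak k : ℂ) • ψ.Z) * S.U) (Sum.inr ()) (Sum.inr ())).re := by
  obtain ⟨-, -, h3, -, -, -, -, -, -⟩ := hψ
  have h := (RCLike.nonneg_iff.1 ((h3 k).diag_nonneg (i := Sum.inr ()))).1
  rw [lmiLeak, Matrix.sub_apply, Matrix.fromBlocks_apply₂₂, Matrix.of_apply, map_sub] at h
  simp only [RCLike.re_to_complex, Complex.ofReal_re] at h
  linarith

/-- Closed subsets of `F_Ψ` with bounded transmit covariances are compact. -/
theorem isCompact_of_tr_le (hK : 0 < K) (hβ : 0 < S.betaA) {s : Set (Psi K M)} (hs : IsClosed s)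
    (hsub : s ⊆ S.FPsi) {R : ℝ} (hW : ∀ ψ ∈ s, ∀ k, tr (ψ.W k) ≤ R)
    (hZ : ∀ ψ ∈ s, tr ψ.Z ≤ R) : IsCompact s := by
  -- The corner entry is continuous in the two covariances, hence bounded on the compact product of
  -- entry balls.
  have hC : ∀ k, ∃ C, ∀ p ∈ entryBall M R ×ˢ entryBall M R, ‖(S.U.conjTranspose *
      (p.1 - (S.rLeak k : ℂ) • p.2) * S.U) (Sum.inr ()) (Sum.inr ())‖ ≤ C := fun k =>
    ((isCompact_entryBall R).prod (isCompact_entryBall R)).exists_bound_of_continuousOn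
      (by fun_prop)
  choose C hC using hC
  set E : Fin K → ℝ := fun k => S.dBar ^ 2 * (S.rLeak k * S.noiseE) / S.alpha
  have hball : IsCompact (entryBall M R) := isCompact_entryBall R
  have hpi : IsCompact (Set.univ.pi fun _ : Fin K => entryBall M R) :=
    isCompact_univ_pi fun _ => hball
  have hcpt := hpi.prod <| hball.prod <| hpi.prod <| hpi.prod <|
    (isCompact_univ_pi fun k : Fin K =>
      isCompact_univ_pi fun _ : {k' : Fin K // k' ≠ k} => hball).prod <|
    (isCompact_univ_pi fun k : Fin K => isCompact_Icc (a := 0) (b := (E k + C k) / S.betaA)).prod <|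
    (isCompact_univ_pi fun _ : Fin K => isCompact_Icc (a := 0) (b := S.dBar ^ 2 / S.betaD)).prod <|
    (isCompact_univ_pi fun k : Fin K => isCompact_Icc (a := 0) (b := E k)).prod <|
    isCompact_univ_pi fun _ : Fin 4 => isCompact_Icc (a := 0) (b := S.Gam2)
  refine hcpt.of_isClosed_subset hs fun (ψ : Psi K M) hψs => ?_
  have hψ := hsub hψs
  obtain ⟨h1, h2, -, -, -, h6, h7, h8, h9⟩ := hsub hψs
  have hWb : ∀ k, ψ.Wb k ∈ entryBall M R := fun k =>
    mem_entryBall_of_le (h7 k).2 (h7 k).1 (hW ψ hψs k)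
  have hZm : ψ.Z ∈ entryBall M R := mem_entryBall (Z_posSemidef hK hψ) (hZ ψ hψs)
  refine ⟨fun k _ => mem_entryBall (W_posSemidef hψ k) (hW ψ hψs k), hZm, fun k _ => hWb k,
    fun k _ => mem_entryBall_of_le (h8 k).2 (h8 k).1 (hZ ψ hψs),
    fun k _ k' _ => mem_entryBall_of_le (h9 k k').2 (h9 k k').1 (hW ψ hψs _),
    fun k _ => ⟨(h1 k).1, ?_⟩, fun k _ => ⟨(h1 k).2.1, (kap2_eta_le hψ k).1⟩,
    fun k _ => ⟨(h1 k).2.2, (kap2_eta_le hψ k).2⟩, fun m _ => ⟨h2 m, ?_⟩⟩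
  · rw [le_div_iff₀ hβ]
    have h := kap1_mul_betaA_le hψ k
    have hb := (Complex.abs_re_le_norm _).trans (hC k (ψ.Wb k, ψ.Z) ⟨hWb k, hZm⟩)
    have he : ψ.eta k ≤ E k := (kap2_eta_le hψ k).2
    refine h.trans ?_
    linarith [neg_abs_le ((S.U.conjTranspose *
      (ψ.Wb k - (S.rLeak k : ℂ) • ψ.Z) * S.U) (Sum.inr ()) (Sum.inr ())).re]
  · exact (Finset.single_le_sum (fun m _ => h2 m) (Finset.mem_univ m)).trans h6

theorem isCompact_FPsiPow (hK : 0 < K) (hβ : 0 < S.betaA) : IsCompact S.FPsiPow := by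
  have key : ∀ {A : CMat M}, ((S.Pmax : ℂ) • (1 : CMat M) - A).PosSemidef →
      tr A ≤ tr ((S.Pmax : ℂ) • (1 : CMat M)) := fun h => by
    have := tr_nonneg h
    rw [tr_sub] at this
    linarith
  exact isCompact_of_tr_le hK hβ S.isClosed_FPsiPow (fun ψ h => h.1)
    (fun ψ h k => key (h.2.1 k)) (fun ψ h => key h.2.2)

end System

/-! ### The Lagrangian: affine in the variables, linear in the multipliers -/

namespace Dual

/-- The linear combination `a D + b D'` of dual variables. -/
def comb (a b : ℝ) (D D' : Dual K M) : Dual K M where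
  lam k := a * D.lam k + b * D'.lam k
  L1 k := a • D.L1 k + b • D'.L1 k
  L2 k := a • D.L2 k + b • D'.L2 k
  L3 k := a • D.L3 k + b • D'.L3 k
  L4 k := a • D.L4 k + b • D'.L4 k
  L5 k k' := a • D.L5 k k' + b • D'.L5 k k'
  L6 k k' := a • D.L6 k k' + b • D'.L6 k k'
  L7 k k' := a • D.L7 k k' + b • D'.L7 k k'

theorem comb_mem_dualSet {a b : ℝ} (ha : 0 ≤ a) (hb : 0 ≤ b) {D D' : Dual K M}
    (hD : D ∈ dualSet K M) (hD' : D' ∈ dualSet K M) : comb a b D D' ∈ dualSet K M := by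
  have psd : ∀ {A B : CMat M}, A.PosSemidef → B.PosSemidef → (a • A + b • B).PosSemidef :=
    fun hA hB => (hA.smul ha).add (hB.smul hb)
  obtain ⟨h1, h2, h3⟩ := hD
  obtain ⟨h1', h2', h3'⟩ := hD'
  refine ⟨fun k => add_nonneg (mul_nonneg ha (h1 k)) (mul_nonneg hb (h1' k)),
    fun k => ⟨?_, ?_, ?_, ?_⟩, fun k k' => ⟨?_, ?_, ?_⟩⟩
  · exact psd (h2 k).1 (h2' k).1
  · exact psd (h2 k).2.1 (h2' k).2.1
  · exact psd (h2 k).2.2.1 (h2' k).2.2.1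
  · exact psd (h2 k).2.2.2 (h2' k).2.2.2
  · exact psd (h3 k k').1 (h3' k k').1
  · exact psd (h3 k k').2.1 (h3' k k').2.1
  · exact psd (h3 k k').2.2 (h3' k k').2.2

theorem sum_lam_comb (a b : ℝ) (D D' : Dual K M) :
    ∑ k, (comb a b D D').lam k = a * ∑ k, D.lam k + b * ∑ k, D'.lam k := by
  simp only [comb, Finset.sum_add_distrib, Finset.mul_sum]

end Dual

theorem power_comb (a b : ℝ) (x y : Psi K M) :
    power (a • x + b • y) = a * power x + b * power y := by
  simp only [power, Psi.Wb_comb, Psi.Z_comb, Pi.add_apply, Pi.smul_apply, tr_add, tr_smul,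
    Finset.sum_add_distrib, ← Finset.mul_sum]
  ring

@[fun_prop]
theorem continuous_power : Continuous (power : Psi K M → ℝ) := by
  unfold power; fun_prop

namespace System

variable (S : System K M)

theorem power_nonneg (hK : 0 < K) {ψ : Psi K M} (hψ : ψ ∈ S.FPsi) : 0 ≤ power ψ := by
  have hZ := tr_nonneg (Z_posSemidef hK hψ)
  obtain ⟨-, -, -, -, -, -, h, -, -⟩ := hψ
  exact add_nonneg (Finset.sum_nonneg fun k _ => tr_nonneg (h k).2) hZ

@[fun_prop]
theorem continuous_h1 (D : Dual K M) : Continuous fun ψ => S.h1 ψ D := by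
  unfold h1; fun_prop

theorem continuous_lagr (e : Fin K → ℝ) (D : Dual K M) : Continuous fun ψ => S.lagr ψ e D := by
  unfold lagr; fun_prop

theorem continuous_lagrBar (e : Fin K → ℝ) (D : Dual K M) :
    Continuous fun ψ => S.lagrBar ψ e D := by
  unfold lagrBar; fun_prop

theorem lagr_eq (ψ : Psi K M) (e : Fin K → ℝ) (D : Dual K M) :
    S.lagr ψ e D = power ψ + S.lagrBar ψ e D := add_assoc _ _ _

theorem h1_comb (a b : ℝ) (x y : Psi K M) (D : Dual K M) :
    S.h1 (a • x + b • y) D = a * S.h1 x D + b * S.h1 y D := by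
  unfold h1
  simp only [Psi.W_comb, Psi.Z_comb, Psi.Wb_comb, Psi.Zb_comb, Psi.Wp_comb, Pi.add_apply,
    Pi.smul_apply, Matrix.mul_add, Matrix.mul_sub, Matrix.mul_smul, tr_add, tr_sub, tr_smul]
  simp only [mul_add a, mul_add b, Finset.mul_sum, Finset.sum_add_distrib, Finset.sum_sub_distrib,
    mul_add, mul_sub]
  simp only [mul_left_comm _ a, mul_left_comm _ b]
  ring

theorem h1_dual_comb (a b : ℝ) (ψ : Psi K M) (D D' : Dual K M) :
    S.h1 ψ (Dual.comb a b D D') = a * S.h1 ψ D + b * S.h1 ψ D' := by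
  unfold h1 Dual.comb
  simp only [Matrix.add_mul, Matrix.smul_mul, tr_add, tr_smul]
  -- The three groups of terms (rates, single-user and pairwise constraints) are matched separately.
  have split : ∀ {x y z x₁ y₁ z₁ x₂ y₂ z₂ : ℝ}, x = a * x₁ + b * x₂ → y = a * y₁ + b * y₂ →
      z = a * z₁ + b * z₂ → x + y + z = a * (x₁ + y₁ + z₁) + b * (x₂ + y₂ + z₂) := by
    intros; subst_vars; ring
  refine split ?_ ?_ ?_
  · rw [Finset.mul_sum, Finset.mul_sum, ← Finset.sum_add_distrib]
    exact Finset.sum_congr rfl fun k _ => by ring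
  · rw [Finset.mul_sum, Finset.mul_sum, ← Finset.sum_add_distrib]
    exact Finset.sum_congr rfl fun k _ => by ring
  · rw [Finset.mul_sum, Finset.mul_sum, ← Finset.sum_add_distrib]
    refine Finset.sum_congr rfl fun k _ => ?_
    rw [Finset.mul_sum, Finset.mul_sum, ← Finset.sum_add_distrib]
    exact Finset.sum_congr rfl fun k' _ => by ring

theorem h2_dual_comb (a b : ℝ) (e : Fin K → ℝ) (D D' : Dual K M) :
    S.h2 e (Dual.comb a b D D') = a * S.h2 e D + b * S.h2 e D' := by
  unfold h2 Dual.comb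
  simp only [tr_add, tr_smul]
  have split : ∀ {x y z x₁ y₁ z₁ x₂ y₂ z₂ : ℝ}, x = a * x₁ + b * x₂ → y = a * y₁ + b * y₂ →
      z = a * z₁ + b * z₂ → x - y + z = a * (x₁ - y₁ + z₁) + b * (x₂ - y₂ + z₂) := by
    intros; subst_vars; ring
  refine split ?_ ?_ ?_
  · rw [Finset.mul_sum, Finset.mul_sum, ← Finset.sum_add_distrib]
    exact Finset.sum_congr rfl fun k _ => by ring
  · rw [Finset.mul_sum, Finset.mul_sum, ← Finset.sum_add_distrib]
    exact Finset.sum_congr rfl fun k _ => by ring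
  · rw [Finset.mul_sum, Finset.mul_sum, ← Finset.sum_add_distrib]
    refine Finset.sum_congr rfl fun k _ => ?_
    rw [Finset.mul_sum, Finset.mul_sum, ← Finset.sum_add_distrib]
    exact Finset.sum_congr rfl fun k' _ => by ring

theorem lagrBar_dual_comb (a b : ℝ) (ψ : Psi K M) (e : Fin K → ℝ) (D D' : Dual K M) :
    S.lagrBar ψ e (Dual.comb a b D D') = a * S.lagrBar ψ e D + b * S.lagrBar ψ e D' := by
  simp only [lagrBar, h1_dual_comb, h2_dual_comb]
  ring

theorem lagrBar_comb {a b : ℝ} (hab : a + b = 1) (x y : Psi K M) (e : Fin K → ℝ) (D : Dual K M) :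
    S.lagrBar (a • x + b • y) e D = a * S.lagrBar x e D + b * S.lagrBar y e D := by
  obtain rfl : b = 1 - a := by linarith
  simp only [lagrBar, h1_comb]
  ring

theorem tr_mul_smul_one_sub (L A : CMat M) (c : ℝ) :
    tr (L * ((c : ℂ) • (1 : CMat M) - A)) = c * tr L - tr (L * A) := by
  simp [Matrix.mul_sub, tr]

theorem tr_mul_sub_sub_smul_one (L A B : CMat M) (c : ℝ) :
    tr (L * (A - (B - (c : ℂ) • (1 : CMat M)))) = c * tr L - tr (L * (B - A)) := by
  rw [← tr_mul_smul_one_sub]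
  congr 2
  abel

/-- The Lagrangian as a sum of pairings of multipliers and constraints. -/
theorem lagrBar_eq (ψ : Psi K M) (e : Fin K → ℝ) (D : Dual K M) :
    S.lagrBar ψ e D = -((∑ k, D.lam k * (tr (S.H k * ψ.Wb k)
        - S.rInfo k * ∑ k', tr (S.H k * ψ.Wp k k')
        - S.rInfo k * tr (S.H k * ψ.Zb k) - S.rInfo k * S.noise k * e k))
      + (∑ k, (tr (D.L1 k * (((e k * S.Pmax : ℝ) : ℂ) • (1 : CMat M) - ψ.Wb k))
        + tr (D.L2 k * (ψ.Wb k - (ψ.W k - (((1 - e k) * S.Pmax : ℝ) : ℂ) • (1 : CMat M))))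
        + tr (D.L3 k * (((e k * S.Pmax : ℝ) : ℂ) • (1 : CMat M) - ψ.Zb k))
        + tr (D.L4 k * (ψ.Zb k - (ψ.Z - (((1 - e k) * S.Pmax : ℝ) : ℂ) • (1 : CMat M))))))
      + ∑ k, ∑ k' : {k' : Fin K // k' ≠ k},
        (tr (D.L5 k k' * (((e k * S.Pmax : ℝ) : ℂ) • (1 : CMat M) - ψ.Wp k k'))
        + tr (D.L6 k k' * (((e k'.1 * S.Pmax : ℝ) : ℂ) • (1 : CMat M) - ψ.Wp k k'))
        + tr (D.L7 k k' * (ψ.Wp k k' - (ψ.W k'.1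
          - (((2 - e k - e k'.1) * S.Pmax : ℝ) : ℂ) • (1 : CMat M)))))) := by
  simp only [tr_mul_smul_one_sub, tr_mul_sub_sub_smul_one]
  have split : ∀ {a b c d f g x y z : ℝ}, a + d = -x → b - f = -y → c + g = -z →
      a + b + c + (d - f + g) = -(x + y + z) := by
    intros; linarith
  refine split ?_ ?_ ?_
  · rw [← Finset.sum_add_distrib, ← Finset.sum_neg_distrib]
    exact Finset.sum_congr rfl fun k _ => by ring
  · rw [← Finset.sum_sub_distrib, ← Finset.sum_neg_distrib]
    exact Finset.sum_congr rfl fun k _ => by ring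
  · rw [← Finset.sum_add_distrib, ← Finset.sum_neg_distrib]
    refine Finset.sum_congr rfl fun k _ => ?_
    rw [← Finset.sum_add_distrib, ← Finset.sum_neg_distrib]
    exact Finset.sum_congr rfl fun k' _ => by ring

end System

/-! ### Weak duality, coercivity and strong duality -/

theorem isHermitian_ofReal_smul_one (c : ℝ) : ((c : ℂ) • (1 : CMat M)).IsHermitian := by
  rw [Matrix.IsHermitian, Matrix.conjTranspose_smul, Matrix.conjTranspose_one]
  simp

theorem exists_posSemidef_tr_mul {A : CMat M} (hA : A.IsHermitian) :
    ∃ B : CMat M, B.PosSemidef ∧ tr (B * A) ≤ 0 ∧ (tr (B * A) = 0 → A.PosSemidef) :=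
  hA.exists_posSemidef_re_trace_mul

namespace System

variable {S : System K M} {ψ : Psi K M} {e : Fin K → ℝ}

theorem H_posSemidef (k : Fin K) : (S.H k).PosSemidef :=
  Matrix.posSemidef_vecMulVec_self_star _

/-- Weak duality. -/
theorem lagrBar_nonpos (hψ : S.Coupling ψ e) {D : Dual K M} (hD : D ∈ dualSet K M) :
    S.lagrBar ψ e D ≤ 0 := by
  obtain ⟨h1, h2, h3, h4, h5, h6, h7, h8⟩ := hψ
  obtain ⟨hl, hL, hL'⟩ := hD
  rw [lagrBar_eq, neg_nonpos]
  refine add_nonneg (add_nonneg ?_ ?_) ?_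
  · exact Finset.sum_nonneg fun k _ => mul_nonneg (hl k) (h1 k)
  · refine Finset.sum_nonneg fun k _ => add_nonneg (add_nonneg (add_nonneg ?_ ?_) ?_) ?_
    · exact tr_mul_nonneg (hL k).1 (h2 k)
    · exact tr_mul_nonneg (hL k).2.1 (h3 k)
    · exact tr_mul_nonneg (hL k).2.2.1 (h4 k)
    · exact tr_mul_nonneg (hL k).2.2.2 (h5 k)
  · refine Finset.sum_nonneg fun k _ => Finset.sum_nonneg fun k' _ =>
      add_nonneg (add_nonneg ?_ ?_) ?_
    · exact tr_mul_nonneg (hL' k k').1 (h6 k k')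
    · exact tr_mul_nonneg (hL' k k').2.1 (h7 k k')
    · exact tr_mul_nonneg (hL' k k').2.2 (h8 k k')

/-- A violated coupling constraint is detected by a multiplier. -/
theorem exists_lagrBar_pos (hK : 0 < K) (hψ : ψ ∈ S.FPsi) (hc : ¬ S.Coupling ψ e) :
    ∃ D ∈ dualSet K M, 0 < S.lagrBar ψ e D := by
  have hone : ∀ c : ℝ, ((c : ℂ) • (1 : CMat M)).IsHermitian := isHermitian_ofReal_smul_one
  have hZ := (Z_posSemidef hK hψ).1
  have hW := fun k => (W_posSemidef hψ k).1
  obtain ⟨-, -, -, -, -, -, hWb, hZb, hWp⟩ := hψ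
  choose B1 p1 n1 z1 using fun k => exists_posSemidef_tr_mul ((hone (e k * S.Pmax)).sub
    (hWb k).2.1)
  choose B2 p2 n2 z2 using fun k => exists_posSemidef_tr_mul ((hWb k).2.1.sub ((hW k).sub
    (hone ((1 - e k) * S.Pmax))))
  choose B3 p3 n3 z3 using fun k => exists_posSemidef_tr_mul ((hone (e k * S.Pmax)).sub
    (hZb k).2.1)
  choose B4 p4 n4 z4 using fun k => exists_posSemidef_tr_mul ((hZb k).2.1.sub (hZ.sub
    (hone ((1 - e k) * S.Pmax))))
  choose B5 p5 n5 z5 using fun k k' => exists_posSemidef_tr_mul ((hone (e k * S.Pmax)).sub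
    (hWp k k').2.1)
  choose B6 p6 n6 z6 using fun k (k' : {k' : Fin K // k' ≠ k}) =>
    exists_posSemidef_tr_mul ((hone (e k' * S.Pmax)).sub
    (hWp k k').2.1)
  choose B7 p7 n7 z7 using fun k (k' : {k' : Fin K // k' ≠ k}) =>
    exists_posSemidef_tr_mul ((hWp k k').2.1.sub
    ((hW k').sub (hone ((2 - e k - e k') * S.Pmax))))
  choose l p0 n0 z0 using fun k => show ∃ l : ℝ, 0 ≤ l ∧
      l * (tr (S.H k * ψ.Wb k) - S.rInfo k * ∑ k', tr (S.H k * ψ.Wp k k')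
        - S.rInfo k * tr (S.H k * ψ.Zb k) - S.rInfo k * S.noise k * e k) ≤ 0 ∧
      (l * (tr (S.H k * ψ.Wb k) - S.rInfo k * ∑ k', tr (S.H k * ψ.Wp k k')
        - S.rInfo k * tr (S.H k * ψ.Zb k) - S.rInfo k * S.noise k * e k) = 0 →
      0 ≤ tr (S.H k * ψ.Wb k) - S.rInfo k * ∑ k', tr (S.H k * ψ.Wp k k')
        - S.rInfo k * tr (S.H k * ψ.Zb k) - S.rInfo k * S.noise k * e k) by
    rcases le_or_gt 0 (tr (S.H k * ψ.Wb k) - S.rInfo k * ∑ k', tr (S.H k * ψ.Wp k k')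
        - S.rInfo k * tr (S.H k * ψ.Zb k) - S.rInfo k * S.noise k * e k) with h | h
    · exact ⟨0, le_rfl, by simp, fun _ => h⟩
    · exact ⟨1, zero_le_one, by simpa using h.le, fun h0 => by simp only [one_mul] at h0; exact h0.ge⟩
  refine ⟨⟨l, B1, B2, B3, B4, B5, B6, B7⟩, ⟨p0, fun k => ⟨p1 k, p2 k, p3 k, p4 k⟩,
    fun k k' => ⟨p5 k k', p6 k k', p7 k k'⟩⟩, ?_⟩
  -- Each pairing is nonpositive by choice of its multiplier. If their sum is nonnegative, all of
  -- them vanish, and every coupling constraint holds.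
  by_contra! hle
  rw [lagrBar_eq, neg_nonpos] at hle
  dsimp only at hle
  have t1 := fun k => add_nonpos (add_nonpos (add_nonpos (n1 k) (n2 k)) (n3 k)) (n4 k)
  have t2 := fun k k' => add_nonpos (add_nonpos (n5 k k') (n6 k k')) (n7 k k')
  have s0 := Finset.sum_nonpos fun k (_ : k ∈ Finset.univ) => n0 k
  have s1 := Finset.sum_nonpos fun k (_ : k ∈ Finset.univ) => t1 k
  have s2' := fun k => Finset.sum_nonpos fun k' (_ : k' ∈ Finset.univ) => t2 k k'
  have s2 := Finset.sum_nonpos fun k (_ : k ∈ Finset.univ) => s2' k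
  have q0 := fun k => (Finset.sum_eq_zero_iff_of_nonpos fun k _ => n0 k).1
    (by linarith) k (Finset.mem_univ k)
  have q1 := fun k => (Finset.sum_eq_zero_iff_of_nonpos fun k _ => t1 k).1
    (by linarith) k (Finset.mem_univ k)
  have q2 := fun k k' => (Finset.sum_eq_zero_iff_of_nonpos fun k' _ => t2 k k').1
    ((Finset.sum_eq_zero_iff_of_nonpos fun k _ => s2' k).1
    (by linarith) k (Finset.mem_univ k)) k' (Finset.mem_univ k')
  refine hc ⟨fun k => z0 k (q0 k), fun k => z1 k ?_, fun k => z2 k ?_, fun k => z3 k ?_,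
    fun k => z4 k ?_, fun k k' => z5 k k' ?_, fun k k' => z6 k k' ?_, fun k k' => z7 k k' ?_⟩
  iterate 4 linarith [n1 k, n2 k, n3 k, n4 k, q1 k]
  iterate 3 linarith [n5 k k', n6 k k', n7 k k', q2 k k']

/-- Adding the two big-M inequalities of a user cancels both the auxiliary matrix and `e_k`, leaving
exactly the power limit. -/
theorem mem_FPsiPow (hK : 0 < K) (hψ : ψ ∈ S.FPsi) (hc : S.Coupling ψ e) : ψ ∈ S.FPsiPow := by
  obtain ⟨-, h2, h3, h4, h5, -, -, -⟩ := hc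
  have key : ∀ {c : ℝ} {A B : CMat M}, (((c * S.Pmax : ℝ) : ℂ) • (1 : CMat M) - A).PosSemidef →
      (A - (B - (((1 - c) * S.Pmax : ℝ) : ℂ) • (1 : CMat M))).PosSemidef →
      ((S.Pmax : ℂ) • (1 : CMat M) - B).PosSemidef := fun {c A B} h h' => by
    convert h.add h' using 1
    push_cast
    module
  exact ⟨hψ, fun k => key (h2 k) (h3 k), key (h4 ⟨0, hK⟩) (h5 ⟨0, hK⟩)⟩

variable (S) in
/-- A dual variable whose Lagrangian is coercive on `F_Ψ`. -/
def coerciveDual : Dual K M where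
  lam _ := 1
  L1 k := 1 + S.H k
  L2 _ := 1
  L3 _ := 1
  L4 _ := 1
  L5 _ _ := 0
  L6 _ _ := 0
  L7 _ _ := 0

theorem coerciveDual_mem : S.coerciveDual ∈ dualSet K M :=
  ⟨fun _ => zero_le_one, fun k => ⟨Matrix.PosSemidef.one.add (H_posSemidef k), .one, .one, .one⟩,
    fun _ _ => ⟨.zero, .zero, .zero⟩⟩

/-- The summand `H_k` of `L1` cancels the only negative term, `-Tr(H_k W̄_k)` from the rate
constraint. The identity multipliers recombine `W̄_k` with `W_k - W̄_k` and `Z̄_k` with `Z - Z̄_k`;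
the interference terms left over are nonnegative. -/
theorem le_lagrBar_coerciveDual (hψ : ψ ∈ S.FPsi) :
    (∑ k, (tr (ψ.W k) + tr ψ.Z)) + S.h2 e S.coerciveDual ≤ S.lagrBar ψ e S.coerciveDual := by
  obtain ⟨-, -, -, -, -, -, -, hZb, hWp⟩ := hψ
  rw [lagrBar]
  gcongr
  simp only [h1, coerciveDual, Matrix.add_mul, Matrix.zero_mul, tr_zero, tr_add,
    tr_sub, add_zero, Finset.sum_const_zero, one_mul]
  rw [← Finset.sum_add_distrib]
  refine Finset.sum_le_sum fun k _ => ?_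
  have h1 := mul_nonneg (S.rInfo_nonneg k) (tr_mul_nonneg (H_posSemidef (S := S) k) (hZb k).2)
  have h2 := mul_nonneg (S.rInfo_nonneg k) (Finset.sum_nonneg fun k' (_ : k' ∈ Finset.univ) =>
    tr_mul_nonneg (H_posSemidef (S := S) k) (hWp k k').2)
  linarith

theorem h2_le_lagrBar_coerciveDual (hK : 0 < K) (hψ : ψ ∈ S.FPsi) :
    S.h2 e S.coerciveDual ≤ S.lagrBar ψ e S.coerciveDual := by
  have h := le_lagrBar_coerciveDual (e := e) hψ
  have h0 : 0 ≤ ∑ k, (tr (ψ.W k) + tr ψ.Z) := Finset.sum_nonneg fun k _ =>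
    add_nonneg (tr_nonneg (W_posSemidef hψ k)) (tr_nonneg (Z_posSemidef hK hψ))
  linarith

theorem isCompact_sublevel (hK : 0 < K) (hβ : 0 < S.betaA) {F : Set (Psi K M)} (hF : IsClosed F)
    (hsub : F ⊆ S.FPsi) {φ : Psi K M → ℝ} (hφ : Continuous φ)
    (hle : ∀ ψ ∈ F, S.lagrBar ψ e S.coerciveDual ≤ φ ψ) (c : ℝ) :
    IsCompact {ψ ∈ F | φ ψ ≤ c} := by
  have key : ∀ ψ ∈ {ψ ∈ F | φ ψ ≤ c}, ∀ k,
      tr (ψ.W k) + tr ψ.Z ≤ c - S.h2 e S.coerciveDual := fun ψ hψ k => by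
    have h1 := le_lagrBar_coerciveDual (e := e) (hsub hψ.1)
    have h2 := Finset.single_le_sum (f := fun k => tr (ψ.W k) + tr ψ.Z) (fun k _ =>
      add_nonneg (tr_nonneg (W_posSemidef (hsub hψ.1) k))
        (tr_nonneg (Z_posSemidef hK (hsub hψ.1)))) (Finset.mem_univ k)
    have h3 := hle ψ hψ.1
    have h4 : φ ψ ≤ c := hψ.2
    linarith
  refine isCompact_of_tr_le hK hβ (hF.inter (isClosed_le hφ continuous_const))
    (fun ψ hψ => hsub hψ.1) (R := c - S.h2 e S.coerciveDual) (fun ψ hψ k => ?_) fun ψ hψ => ?_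
  · linarith [key ψ hψ k, tr_nonneg (Z_posSemidef hK (hsub hψ.1))]
  · linarith [key ψ hψ ⟨0, hK⟩, tr_nonneg (W_posSemidef (hsub hψ.1) ⟨0, hK⟩)]

/-- Strong duality for the minimization of a nonnegative convex objective `q`. -/
theorem exists_dual_le (hK : 0 < K) (hβ : 0 < S.betaA) {F : Set (Psi K M)} (hF : IsClosed F)
    (hconv : Convex ℝ F) (hsub : F ⊆ S.FPsi) {q : Psi K M → ℝ} (hq : Continuous q)
    (hqc : ConvexOn ℝ F q) (hq0 : ∀ ψ ∈ F, 0 ≤ q ψ) {c : ℝ}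
    (hc : ∀ ψ ∈ F, S.Coupling ψ e → c < q ψ) :
    ∃ D ∈ dualSet K M, ∀ ψ ∈ F, c ≤ q ψ + S.lagrBar ψ e D := by
  suffices h : ∃ φ ∈ {φ | ∃ D ∈ dualSet K M, φ = fun ψ => q ψ + S.lagrBar ψ e D},
      ∀ ψ ∈ F, c ≤ φ ψ by
    obtain ⟨φ, ⟨D, hD, rfl⟩, hφ⟩ := h
    exact ⟨D, hD, hφ⟩
  refine exists_forall_le_of_isCompact_sublevel hconv ?_ ?_ ?_
    ⟨S.coerciveDual, coerciveDual_mem, rfl⟩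
    (isCompact_sublevel hK hβ hF hsub (hq.add (S.continuous_lagrBar e _))
      (fun ψ hψ => le_add_of_nonneg_left (hq0 ψ hψ)) c) ?_
  · rintro _ ⟨D, hD, rfl⟩ _ ⟨D', hD', rfl⟩ a b ha hb hab
    refine ⟨Dual.comb a b D D', Dual.comb_mem_dualSet ha hb hD hD', ?_⟩
    ext ψ
    obtain rfl : b = 1 - a := by linarith
    simp only [Pi.add_apply, Pi.smul_apply, smul_eq_mul, lagrBar_dual_comb]
    ring
  · rintro _ ⟨D, hD, rfl⟩
    refine hqc.add ⟨hconv, fun x _ y _ a b _ _ hab => ?_⟩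
    exact (S.lagrBar_comb hab x y e D).le
  · rintro _ ⟨D, hD, rfl⟩
    exact hq.add (S.continuous_lagrBar e D)
  · intro ψ hψ
    by_cases hcp : S.Coupling ψ e
    -- The zero multiplier leaves the objective, which exceeds `c` at feasible points.
    · refine ⟨_, ⟨Dual.comb 0 0 S.coerciveDual S.coerciveDual,
        Dual.comb_mem_dualSet le_rfl le_rfl coerciveDual_mem coerciveDual_mem, rfl⟩, ?_⟩
      simpa [lagrBar_dual_comb] using hc ψ hψ hcp
    · obtain ⟨D, hD, hpos⟩ := exists_lagrBar_pos hK (hsub hψ) hcp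
      -- Scaling the detecting multiplier pushes the Lagrangian above `c`, since `q` is nonnegative.
      obtain ⟨n, hn⟩ := exists_nat_gt (c / S.lagrBar ψ e D)
      refine ⟨_, ⟨Dual.comb n 0 D D,
        Dual.comb_mem_dualSet n.cast_nonneg le_rfl hD hD, rfl⟩, ?_⟩
      rw [div_lt_iff₀ hpos] at hn
      simp only [lagrBar_dual_comb, zero_mul, add_zero]
      linarith [hq0 ψ hψ]

/-! ### Exactness of the cuts and equivalence of the two problems -/

theorem feasCuts_of_mem_feasE (hK : 0 < K) {F : Set (Psi K M)} (hsup : S.FPsiPow ⊆ F)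
    (he : e ∈ S.feasE) : S.FeasCuts F e := by
  obtain ⟨ψ, hψ, hc⟩ := he
  intro D hD _
  exact (iInf₂_le ψ (hsup (mem_FPsiPow hK hψ hc))).trans
    (EReal.coe_le_coe_iff.2 (lagrBar_nonpos hc hD))

/-- For infeasible `e`, duality with zero objective gives a multiplier with Lagrangian at least `1`
on `F`. All its `λ_k` may vanish, which would rule out the normalization; adding `coerciveDual`
makes their sum positive. -/
theorem mem_feasE_of_feasCuts (hK : 0 < K) (hβ : 0 < S.betaA) {F : Set (Psi K M)}
    (hF : IsClosed F) (hconv : Convex ℝ F) (hsub : F ⊆ S.FPsi) (hcuts : S.FeasCuts F e) :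
    e ∈ S.feasE := by
  by_contra hne
  obtain ⟨D, hD, hle⟩ := exists_dual_le (S := S) (e := e) (q := fun _ => 0) (c := 1) hK hβ hF hconv
    hsub continuous_const (convexOn_const 0 hconv) (fun _ _ => le_rfl)
    fun ψ hψ hc => absurd ⟨ψ, hsub hψ, hc⟩ hne
  set b : ℝ := |S.h2 e S.coerciveDual|
  -- The Lagrangian of `coerciveDual` is at least `-b` on `F`, so the weight `b + 1` keeps the total
  -- at least `(b + 1) - b = 1`.
  set D' := Dual.comb (b + 1) 1 D S.coerciveDual with hD'
  have hb : 0 ≤ b := abs_nonneg _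
  have hD'mem : D' ∈ dualSet K M :=
    Dual.comb_mem_dualSet (by linarith) zero_le_one hD coerciveDual_mem
  have hpos : 0 < ∑ k, D'.lam k := by
    have h1 : 0 ≤ ∑ k, D.lam k := Finset.sum_nonneg fun k _ => hD.1 k
    have h2 : ∑ k, S.coerciveDual.lam k = K := by simp [coerciveDual]
    have h3 : (0 : ℝ) < K := Nat.cast_pos.2 hK
    rw [hD', Dual.sum_lam_comb, h2]
    positivity
  have hle' : ∀ ψ ∈ F, 1 ≤ S.lagrBar ψ e D' := fun ψ hψ => by
    have h1 := hle ψ hψ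
    have h2 := h2_le_lagrBar_coerciveDual (e := e) hK (hsub hψ)
    have h3 : -b ≤ S.h2 e S.coerciveDual := neg_abs_le _
    rw [hD', lagrBar_dual_comb]
    nlinarith
  set t := (∑ k, D'.lam k)⁻¹ with ht
  have htpos : 0 < t := inv_pos.2 hpos
  have hcut := hcuts (Dual.comb t 0 D' D')
    (Dual.comb_mem_dualSet htpos.le le_rfl hD'mem hD'mem) (by
      rw [Dual.sum_lam_comb, zero_mul, add_zero, ht, inv_mul_cancel₀ hpos.ne'])
  have hge : (t : EReal) ≤ S.xiBar F e (Dual.comb t 0 D' D') :=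
    le_iInf₂ fun ψ hψ => EReal.coe_le_coe_iff.2 <| by
      rw [lagrBar_dual_comb, zero_mul, add_zero]
      exact le_mul_of_one_le_right htpos.le (hle' ψ hψ)
  exact absurd (EReal.coe_le_coe_iff.1 (hge.trans hcut)) (not_le.2 htpos)

theorem xi_le_g (hK : 0 < K) {F : Set (Psi K M)} (hsup : S.FPsiPow ⊆ F) {D : Dual K M}
    (hD : D ∈ dualSet K M) : S.xi F e D ≤ S.g e :=
  le_iInf₂ fun ψ hψ => (iInf₂_le ψ (hsup (mem_FPsiPow hK hψ.1 hψ.2))).trans <|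
    EReal.coe_le_coe_iff.2 <| by
      rw [lagr_eq]
      linarith [lagrBar_nonpos hψ.2 hD]

/-- Every real `c < g(e)` is a lower bound for some Lagrangian on `F`. Infeasible `e` are included,
both sides then being `⊤`. -/
theorem g_eq_iSup_xi (hK : 0 < K) (hβ : 0 < S.betaA) {F : Set (Psi K M)}
    (hF : IsClosed F) (hconv : Convex ℝ F) (hsub : F ⊆ S.FPsi) (hsup : S.FPsiPow ⊆ F) :
    S.g e = ⨆ D ∈ dualSet K M, S.xi F e D := by
  refine le_antisymm (EReal.ge_of_forall_gt_iff_ge.1 fun c hc => ?_)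
    (iSup₂_le fun D hD => xi_le_g hK hsup hD)
  obtain ⟨D, hD, hle⟩ := exists_dual_le (S := S) (e := e) (c := c) hK hβ hF hconv hsub
    continuous_power ⟨hconv, fun x _ y _ a b _ _ _ => (power_comb a b x y).le⟩
    (fun ψ hψ => S.power_nonneg hK (hsub hψ))
    fun ψ hψ hcp => EReal.coe_lt_coe_iff.1 (hc.trans_le (iInf₂_le ψ ⟨hsub hψ, hcp⟩))
  refine le_iSup₂_of_le D hD (le_iInf₂ fun ψ hψ => EReal.coe_le_coe_iff.2 ?_)
  rw [lagr_eq]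
  exact hle ψ hψ

theorem g_ne_bot (hK : 0 < K) : S.g e ≠ ⊥ :=
  ne_bot_of_le_ne_bot (b := 0) EReal.zero_ne_bot <| le_iInf₂ fun _ hψ =>
    EReal.coe_nonneg.2 (S.power_nonneg hK hψ.1)

/-- Finiteness makes `(e, g(e))` an admissible pair with real second component, as the comparison of
optima requires. -/
theorem exists_g_eq_coe (hK : 0 < K) (he : e ∈ S.feasE) : ∃ μ : ℝ, S.g e = (μ : EReal) := by
  obtain ⟨ψ, hψ, hc⟩ := he
  have htop : S.g e ≠ ⊤ := ne_top_of_le_ne_top (EReal.coe_ne_top (power ψ)) (iInf₂_le ψ ⟨hψ, hc⟩)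
  exact ⟨(S.g e).toReal, (EReal.coe_toReal htop (g_ne_bot hK)).symm⟩

theorem mem_cutFeas_iff (hK : 0 < K) (hβ : 0 < S.betaA) {F : Set (Psi K M)}
    (hF : IsClosed F) (hconv : Convex ℝ F) (hsub : F ⊆ S.FPsi) (hsup : S.FPsiPow ⊆ F) (μ : ℝ) :
    (e, μ) ∈ S.cutFeas F ↔ e ∈ S.Fe ∩ S.feasE ∧ S.g e ≤ (μ : EReal) := by
  have hg : S.g e ≤ (μ : EReal) ↔ S.OptCuts F e μ := by
    rw [g_eq_iSup_xi hK hβ hF hconv hsub hsup, iSup₂_le_iff]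
    rfl
  have hE : e ∈ S.feasE ↔ S.FeasCuts F e :=
    ⟨feasCuts_of_mem_feasE hK hsup, mem_feasE_of_feasCuts hK hβ hF hconv hsub⟩
  rw [hg, Set.mem_inter_iff, hE, and_assoc, and_comm (a := S.FeasCuts F e)]
  rfl

theorem iInf_g_eq (hK : 0 < K) (hβ : 0 < S.betaA) {F : Set (Psi K M)}
    (hF : IsClosed F) (hconv : Convex ℝ F) (hsub : F ⊆ S.FPsi) (hsup : S.FPsiPow ⊆ F) :
    (⨅ e ∈ S.Fe ∩ S.feasE, S.g e) = ⨅ p ∈ S.cutFeas F, ((p.2 : ℝ) : EReal) := by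
  refine le_antisymm (le_iInf₂ fun p hp => ?_) (le_iInf₂ fun e he => ?_)
  · obtain ⟨he, hle⟩ := (mem_cutFeas_iff hK hβ hF hconv hsub hsup p.2).1 hp
    exact (iInf₂_le p.1 he).trans hle
  · obtain ⟨μ, hμ⟩ := exists_g_eq_coe hK he.2
    rw [hμ]
    exact iInf₂_le (e, μ) ((mem_cutFeas_iff hK hβ hF hconv hsub hsup μ).2 ⟨he, hμ.le⟩)

theorem g_eq_of_cutOpt (hK : 0 < K) (hβ : 0 < S.betaA) {F : Set (Psi K M)}
    (hF : IsClosed F) (hconv : Convex ℝ F) (hsub : F ⊆ S.FPsi) (hsup : S.FPsiPow ⊆ F) {μ : ℝ}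
    (h : S.CutOpt F e μ) : S.g e = (μ : EReal) := by
  obtain ⟨he, hle⟩ := (mem_cutFeas_iff hK hβ hF hconv hsub hsup μ).1 h.1
  obtain ⟨ν, hν⟩ := exists_g_eq_coe hK he.2
  refine le_antisymm hle ?_
  rw [hν]
  exact EReal.coe_le_coe_iff.2
    (h.2 (e, ν) ((mem_cutFeas_iff hK hβ hF hconv hsub hsup ν).2 ⟨he, hν.le⟩))

theorem masterOpt_iff (hK : 0 < K) (hβ : 0 < S.betaA) {F : Set (Psi K M)}
    (hF : IsClosed F) (hconv : Convex ℝ F) (hsub : F ⊆ S.FPsi) (hsup : S.FPsiPow ⊆ F) :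
    S.MasterOpt e ↔ ∃ μ : ℝ, S.CutOpt F e μ := by
  constructor
  · rintro ⟨he, hmin⟩
    obtain ⟨μ, hμ⟩ := exists_g_eq_coe hK he.2
    refine ⟨μ, (mem_cutFeas_iff hK hβ hF hconv hsub hsup μ).2 ⟨he, hμ.le⟩, fun p hp => ?_⟩
    obtain ⟨hp, hle⟩ := (mem_cutFeas_iff hK hβ hF hconv hsub hsup p.2).1 hp
    rw [← EReal.coe_le_coe_iff, ← hμ]
    exact (hmin p.1 hp).trans hle
  · rintro ⟨μ, h⟩
    refine ⟨((mem_cutFeas_iff hK hβ hF hconv hsub hsup μ).1 h.1).1, fun e' he' => ?_⟩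
    obtain ⟨ν, hν⟩ := exists_g_eq_coe hK he'.2
    rw [g_eq_of_cutOpt hK hβ hF hconv hsub hsup h, hν]
    exact EReal.coe_le_coe_iff.2
      (h.2 (e', ν) ((mem_cutFeas_iff hK hβ hF hconv hsub hsup ν).2 ⟨he', hν.le⟩))

end System

/-! ### Attainment and conclusion -/

/-- The infimum of a continuous real function over a nonempty compact set is attained. -/
theorem exists_iInf_coe_eq {X : Type*} [TopologicalSpace X] {s : Set X} (hs : IsCompact s)
    (hne : s.Nonempty) {φ : X → ℝ} (hφ : Continuous φ) :
    ∃ x ∈ s, (⨅ y ∈ s, ((φ y : ℝ) : EReal)) = ((φ x : ℝ) : EReal) := by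
  obtain ⟨x, hx, hmin⟩ := hs.exists_isMinOn hne hφ.continuousOn
  exact ⟨x, hx, le_antisymm (iInf₂_le x hx)
    (le_iInf₂ fun y hy => EReal.coe_le_coe_iff.2 (hmin hy))⟩

end SecureNF

end

theorem proposition2 {K M : ℕ} (hK : 0 < K) (S : SecureNF.System K M) (hβ : 0 < S.betaA) :
    (∀ F : Set (SecureNF.Psi K M), F = S.FPsi ∨ F = S.FPsiPow →
      (∀ e ∈ S.Fe, e ∈ S.feasE ↔ S.FeasCuts F e) ∧
      (∀ e ∈ S.Fe ∩ S.feasE, S.g e = ⨆ D ∈ SecureNF.dualSet K M, S.xi F e D) ∧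
      (∀ (e : Fin K → ℝ) (μ : ℝ),
        (e, μ) ∈ S.cutFeas F ↔ e ∈ S.Fe ∩ S.feasE ∧ S.g e ≤ (μ : EReal)) ∧
      (⨅ e ∈ S.Fe ∩ S.feasE, S.g e) = (⨅ p ∈ S.cutFeas F, ((p.2 : ℝ) : EReal)) ∧
      (∀ e : Fin K → ℝ, S.MasterOpt e ↔ ∃ μ : ℝ, S.CutOpt F e μ) ∧
      (∀ (e : Fin K → ℝ) (μ : ℝ), S.CutOpt F e μ → S.g e = (μ : EReal))) ∧
    (S.FPsiPow.Nonempty → ∀ e ∈ S.Fe, ∀ D ∈ SecureNF.dualSet K M,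
      (∃ ψ ∈ S.FPsiPow, S.xi S.FPsiPow e D = ((S.lagr ψ e D : ℝ) : EReal)) ∧
      (∃ ψ ∈ S.FPsiPow, S.xiBar S.FPsiPow e D = ((S.lagrBar ψ e D : ℝ) : EReal))) := by
  refine ⟨fun F hF => ?_, fun hne e _ D _ =>
    ⟨SecureNF.exists_iInf_coe_eq (SecureNF.System.isCompact_FPsiPow hK hβ) hne
      (S.continuous_lagr e D),
    SecureNF.exists_iInf_coe_eq (SecureNF.System.isCompact_FPsiPow hK hβ) hne
      (S.continuous_lagrBar e D)⟩⟩
  -- Only these four properties of `F` enter the equivalence.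
  obtain ⟨hcl, hconv, hsub, hsup⟩ :
      IsClosed F ∧ Convex ℝ F ∧ F ⊆ S.FPsi ∧ S.FPsiPow ⊆ F := by
    rcases hF with rfl | rfl
    · exact ⟨S.isClosed_FPsi, S.convex_FPsi, subset_rfl, fun ψ h => h.1⟩
    · exact ⟨S.isClosed_FPsiPow, S.convex_FPsiPow, fun ψ h => h.1, subset_rfl⟩
  exact ⟨fun e _ => ⟨SecureNF.System.feasCuts_of_mem_feasE hK hsup,
      SecureNF.System.mem_feasE_of_feasCuts hK hβ hcl hconv hsub⟩,
    fun e _ => SecureNF.System.g_eq_iSup_xi hK hβ hcl hconv hsub hsup,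
    fun e μ => SecureNF.System.mem_cutFeas_iff hK hβ hcl hconv hsub hsup μ,
    SecureNF.System.iInf_g_eq hK hβ hcl hconv hsub hsup,
    fun e => SecureNF.System.masterOpt_iff hK hβ hcl hconv hsub hsup,
    fun e μ => SecureNF.System.g_eq_of_cutOpt hK hβ hcl hconv hsub hsup⟩
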